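/- Let $0<\alpha<1$ and $\gamma_1,\gamma_2\in\mathbb R$. Let $C_0(\mathbb R)$ be the continuous functions vanishing at $\pm\infty$ and $C_0^2(\mathbb R)=\{f\in C^2(\mathbb R): f,f',f''\in C_0(\mathbb R)\}$. For $f\in C_0^2(\mathbb R)$ the Caputo derivative $$D^\alpha f(x)=\frac1{\Gamma(1-\alpha)}\int_{-\infty}^x\frac{f'(y)}{(x-y)^\alpha}\,dy$$ exists as an improper integral (at $-\infty$) for every $x\in\mathbb R$. Let $L u=\gamma_1D^\alpha u+\gamma_2u''$. A Lévy operator is an operator of the form $f\mapsto \frac12Af''(x)+\gamma f'(x)+\int_{\mathbb R}\big(f(x+y)-f(x)-yf'(x)1_{(-1,1)}(y)\big)\,\nu(dy)$ on $C_0^2(\mathbb R)$, with $A\ge0$, $\gamma\in\mathbb R$ and a measure $\nu$ on $\mathbb R$ such that $\nu(\{0\})=0$ and $\int\min(1,y^2)\,\nu(dy)<\infty$. A heat kernel of $L$ is a family $(p_t)_{t\ge0}$ of probability measures on $\mathbb R$ with $p_0=\delta_0$, $p_{s+t}=p_s*p_t$, such that, with $S_tf(x)=\int f(x-y)\,p_t(dy)$,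 as $t\downarrow0$ one has $S_tf\to f$ uniformly for all $f\in C_0(\mathbb R)$ and $(S_tf-f)/t\to Lf$ uniformly for all $f\in C_0^2(\mathbb R)$. Put $\psi(k)=-|k|^\alpha\exp\big(-i\,\mathrm{sgn}(k)\,\alpha\pi/2\big)$ and, for $\tau>0$, $G(x,\tau)=\frac1{2\pi}\int_{\mathbb R}e^{-ikx}e^{\tau\psi(k)}\,dk$. Then: 1. $L$ is a Lévy operator if and only if $\gamma_1\le0$ and $\gamma_2\ge0$. 2. For every $\tau>0$, $G(\cdot,\tau)$ is a one-sided strictly $\alpha$-stable probability density, vanishing on $(-\infty,0]$. (A law $\mu$ is strictly $\alpha$-stable if, for independent $X,Y\sim\mu$ and all $a,b>0$, $aX+bY$ has the law of $(a^\alpha+b^\alpha)^{1/\alpha}X$.) 3. If $L$ is a Lévy operator, then $L$ has exactly one heat kernel $(p_t)_{t\ge0}$. For all $t\ge0$ and $k\in\mathbb R$, $$\int_{\mathbb R}e^{ikx}\,p_t(dx)=\exp\big(t(|\gamma_1|\psi(k)-\gamma_2k^2)\big),$$ and $p_t$ is the convolution of the law with density $G(\cdot,|\gamma_1|t)$ with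 the Gaussian law of mean $0$ and variance $2\gamma_2t$, where either factor is $\delta_0$ if its parameter ($|\gamma_1|t$ or $2\gamma_2t$) is $0$. 4. If $L$ is a Lévy operator, then its heat kernel is strictly positive if and only if $\gamma_2>0$; more precisely, for each $t>0$, $p_t$ has a continuous density that is strictly positive on all of $\mathbb R$ if and only if $\gamma_2>0$. -/

import Mathlib

open MeasureTheory ProbabilityTheory Filter Topology
open scoped NNReal ENNReal

noncomputable section

/-- `f ∈ C₀(ℝ)`: `f` is continuous and vanishes at `±∞`. -/
def IsC0 (f : ℝ → ℝ) : Prop :=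
  Continuous f ∧ Tendsto f (cocompact ℝ) (𝓝 0)

/-- `f ∈ C₀²(ℝ)`: `f` is twice continuously differentiable and `f, f', f'' ∈ C₀(ℝ)`. -/
def IsC02 (f : ℝ → ℝ) : Prop :=
  ContDiff ℝ 2 f ∧ IsC0 f ∧ IsC0 (deriv f) ∧ IsC0 (deriv (deriv f))

/-- A Lévy measure on `ℝ`: `ν({0}) = 0` and `∫ min(1, y²) ν(dy) < ∞`. -/
def IsLevyMeasure (ν : Measure ℝ) : Prop :=
  ν {0} = 0 ∧ ∫⁻ y, ENNReal.ofReal (min 1 (y ^ 2)) ∂ν < ∞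

/-- `L` is a Lévy operator: on `C₀²(ℝ)` it is given by
`L f(x) = ½ A f''(x) + γ f'(x) + ∫ (f(x+y) - f(x) - y f'(x) 1_{(-1,1)}(y)) ν(dy)`
with `A ≥ 0`, `γ ∈ ℝ` and a Lévy measure `ν`. (The integrand is `ν`-integrable, being
bounded by a multiple of `min(1, y²)`.) -/
def IsLevyOperator (L : (ℝ → ℝ) → ℝ → ℝ) : Prop :=
  ∃ (A γ : ℝ) (ν : Measure ℝ), 0 ≤ A ∧ IsLevyMeasure ν ∧
    ∀ f : ℝ → ℝ, IsC02 f → ∀ x : ℝ,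
      L f x = 1 / 2 * A * deriv (deriv f) x + γ * deriv f x
        + ∫ y, (f (x + y) - f x
            - y * deriv f x * (Set.Ioo (-1 : ℝ) 1).indicator (fun _ => (1 : ℝ)) y) ∂ν

/-- The truncated Caputo integral `1/Γ(1-α) ∫_R^x f'(y) / (x-y)^α dy`. -/
def caputoTrunc (α : ℝ) (f : ℝ → ℝ) (x R : ℝ) : ℝ :=
  1 / Real.Gamma (1 - α) * ∫ y in R..x, deriv f y / (x - y) ^ α

/-- The Caputo integral `∫_{-∞}^x f'(y) / (x-y)^α dy` converges, as an improper integral at `-∞`.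
(For `f ∈ C₀²(ℝ)` it need not converge absolutely at `-∞`.) -/
def CaputoConverges (α : ℝ) (f : ℝ → ℝ) (x : ℝ) : Prop :=
  (∀ R ≤ x, IntervalIntegrable (fun y => deriv f y / (x - y) ^ α) volume R x) ∧
    ∃ l : ℝ, Tendsto (caputoTrunc α f x) atBot (𝓝 l)

/-- The Caputo derivative of order `α ∈ (0,1)` on the line,
`D^α f(x) = 1/Γ(1-α) ∫_{-∞}^x f'(y) / (x-y)^α dy`, as an improper integral at `-∞`. -/
def caputo (α : ℝ) (f : ℝ → ℝ) (x : ℝ) : ℝ :=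
  limUnder atBot (caputoTrunc α f x)

/-- The operator `γ₁ D^α u + γ₂ u''`. -/
def caputoDiffusion (α γ₁ γ₂ : ℝ) (u : ℝ → ℝ) (x : ℝ) : ℝ :=
  γ₁ * caputo α u x + γ₂ * deriv (deriv u) x

/-- A convolution semigroup of probability measures on `ℝ`: `p₀ = δ₀`, `p_{s+t} = p_s ∗ p_t`, and
`p_t ∗ f → f` uniformly as `t ↓ 0` for every `f ∈ C₀(ℝ)`. -/
structure IsConvolutionSemigroup (p : ℝ≥0 → Measure ℝ) : Prop where
  isProbabilityMeasure : ∀ t, IsProbabilityMeasure (p t)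
  zero : p 0 = Measure.dirac 0
  add : ∀ s t, p (s + t) = (p s).conv (p t)
  tendsto : ∀ f : ℝ → ℝ, IsC0 f →
    TendstoUniformly (fun (t : ℝ≥0) x => ∫ y, f (x - y) ∂(p t)) f (𝓝[>] 0)

/-- `p` is a heat kernel of `L`: a convolution semigroup such that the semigroup
`S_t f = p_t ∗ f` on `C₀(ℝ)` satisfies `(S_t f - f) / t → L f` uniformly as `t ↓ 0`, for all
`f ∈ C₀²(ℝ)`. -/
structure IsHeatKernel (L : (ℝ → ℝ) → ℝ → ℝ) (p : ℝ≥0 → Measure ℝ) : Prop where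
  semigroup : IsConvolutionSemigroup p
  generator : ∀ f : ℝ → ℝ, IsC02 f →
    TendstoUniformly (fun (t : ℝ≥0) x => ((∫ y, f (x - y) ∂(p t)) - f x) / (t : ℝ)) (L f) (𝓝[>] 0)

/-- The Riesz-Feller symbol `ψ^a_θ(k) = -|k|^a exp(i sgn(k) θ π/2)`. -/
def rieszFellerSymbol (a θ k : ℝ) : ℂ :=
  -((|k| ^ a : ℝ) : ℂ) * Complex.exp (Complex.I * (((SignType.sign k : ℝ) * θ * Real.pi / 2 : ℝ) : ℂ))

/-- The Riesz-Feller kernel `G^a_θ(x,t) = (1/2π) ∫ e^{-ikx} exp(t ψ^a_θ(k)) dk`. The integral is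
real, since its integrand at `-k` is the conjugate of its integrand at `k`. -/
def rieszFellerKernel (a θ x t : ℝ) : ℝ :=
  (1 / (2 * (Real.pi : ℂ)) * ∫ k : ℝ, Complex.exp (-(Complex.I * k * x))
    * Complex.exp (t * rieszFellerSymbol a θ k)).re

/-- The law with density `G^a_θ(·,t)` for `t ≠ 0`, and `δ₀` for `t = 0`. -/
def rieszFellerLaw (a θ t : ℝ) : Measure ℝ :=
  if t = 0 then Measure.dirac 0
  else volume.withDensity fun x => ENNReal.ofReal (rieszFellerKernel a θ x t)

/-- A strictly `α`-stable law: if `X, Y` are independent with law `μ` and `a, b > 0`, then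
`a X + b Y` has the law of `(a^α + b^α)^{1/α} X`. -/
def IsStrictlyStable (α : ℝ) (μ : Measure ℝ) : Prop :=
  ∀ a b : ℝ, 0 < a → 0 < b →
    (μ.map (fun x => a * x)).conv (μ.map (fun x => b * x))
      = μ.map (fun x => (a ^ α + b ^ α) ^ (1 / α) * x)

/-- `g` is a one-sided strictly `α`-stable probability density, vanishing on `(-∞, 0]`. -/
structure IsOneSidedStableDensity (α : ℝ) (g : ℝ → ℝ) : Prop where
  nonneg : ∀ x, 0 ≤ g x
  eq_zero : ∀ x ≤ 0, g x = 0
  integrable : Integrable g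
  integral_eq_one : ∫ x, g x = 1
  stable : IsStrictlyStable α (volume.withDensity fun x => ENNReal.ofReal (g x))

/-- `μ` has a (continuous) Lebesgue density which is strictly positive on all of `ℝ`. -/
def HasStrictlyPositiveDensity (μ : Measure ℝ) : Prop :=
  ∃ g : ℝ → ℝ, Continuous g ∧ (∀ x, 0 < g x) ∧ μ = volume.withDensity fun x => ENNReal.ofReal (g x)

end

/-! On `C₀²` an integration by parts turns `-D^α` into `G f(x) = ∫_0^∞ (f(x-u) - f(x)) ν(du)` with
`ν(du) = α/Γ(1-α) u^(-α-1) du`. As `α < 1`, `min 1 u` is `ν`-integrable and no compensator is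
needed, so `γ₁ ≤ 0 ≤ γ₂` gives a Lévy operator with jumps to the left. Conversely, Lévy operators
obey the positive maximum principle (`IsLevyOperator.nonpos`). A bump with a strict maximum and zero
second derivative there forces `γ₁ ≤ 0`; narrow Gaussians, for which `f''` is of order `s²` and `G
f` only `O(s)`, force `γ₂ ≥ 0`.

The Lévy–Khintchine integral of `ν` is the boundary value of the Laplace exponent `-z^α`, identified
by a Gamma integral on the real axis and analytic continuation (`laplaceExponent_eq`).

The stable law is the limit of `n`-fold convolutions of Pareto laws, each of them `(τ/n)ν` cut off
where its mass is one. Their characteristic functions tend to `exp(τψ)`, which is integrable because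
`Re ψ = -cos(απ/2)|k|^α`. Gaussian smoothing, Fatou and Fourier inversion make its inverse transform
a probability density (`invCharFun_of_tendsto`). Support in `[0,∞)` passes to the weak limit, and
strict stability is the homogeneity of `ψ`.

A Pareto step is an Euler step for `G` with uniform error `o(h)`. Telescoping carries this to the
stable semigroup (`exists_abs_convOp_rieszFellerLaw_sub_le`), and a Taylor expansion treats the
Gaussian factor. Two heat kernels of one operator differ by `o(t/n)` over each of `n` steps, hence
coincide (`IsHeatKernel.unique`). A nondegenerate Gaussian factor makes the density positive
everywhere; without it the law is carried by `[0,∞)`. -/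

/-! ### Convolution operators -/

/-- The convolution operator `f ↦ μ ∗ f`. -/
noncomputable def convOp (μ : Measure ℝ) (f : ℝ → ℝ) (x : ℝ) : ℝ := ∫ y, f (x - y) ∂μ

section ConvOp

variable {μ ν : Measure ℝ} {f g : ℝ → ℝ} {B : ℝ}

lemma integrable_of_continuous_of_bounded [IsFiniteMeasure μ] (hf : Continuous f)
    (hB : ∀ x, |f x| ≤ B) : Integrable f μ :=
  Integrable.of_bound hf.aestronglyMeasurable B (ae_of_all _ hB)

lemma integrable_comp_sub [IsFiniteMeasure μ] (hf : Continuous f) (hB : ∀ x, |f x| ≤ B) (x : ℝ) :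
    Integrable (fun y => f (x - y)) μ :=
  integrable_of_continuous_of_bounded (B := B) (by fun_prop) fun y => hB (x - y)

lemma abs_convOp_le [IsProbabilityMeasure μ] (hB : ∀ x, |f x| ≤ B) (x : ℝ) :
    |convOp μ f x| ≤ B := by
  have := norm_integral_le_of_norm_le_const (μ := μ) (f := fun y => f (x - y)) (C := B)
    (ae_of_all μ fun y => hB (x - y))
  simpa [convOp] using this

lemma continuous_convOp [IsFiniteMeasure μ] (hf : Continuous f) (hB : ∀ x, |f x| ≤ B) :
    Continuous (convOp μ f) := by
  refine continuous_of_dominated (bound := fun _ => B) (fun x => ?_) (fun x => ae_of_all _ fun y => ?_)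
    (integrable_const B) (ae_of_all _ fun y => ?_)
  · exact (integrable_comp_sub hf hB x).aestronglyMeasurable
  · exact hB (x - y)
  · fun_prop

lemma convOp_conv [IsFiniteMeasure μ] [IsFiniteMeasure ν] (hf : Continuous f)
    (hB : ∀ x, |f x| ≤ B) (x : ℝ) :
    convOp (μ.conv ν) f x = convOp μ (convOp ν f) x := by
  unfold convOp
  rw [integral_conv (integrable_comp_sub hf hB x)]
  simp only [sub_sub]

lemma convOp_sub [IsFiniteMeasure μ] {C : ℝ} (hf : Continuous f) (hB : ∀ x, |f x| ≤ B)
    (hg : Continuous g) (hC : ∀ x, |g x| ≤ C) (x : ℝ) :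
    convOp μ (fun z => f z - g z) x = convOp μ f x - convOp μ g x :=
  integral_sub (integrable_comp_sub hf hB x) (integrable_comp_sub hg hC x)

lemma convOp_const_mul (c x : ℝ) : convOp μ (fun z => c * g z) x = c * convOp μ g x :=
  integral_const_mul _ _

@[simp]
lemma convOp_dirac_zero : convOp (Measure.dirac 0) f = f := by
  ext x
  simp [convOp]

/-- Approximation of the identity, with an explicit error. -/
lemma abs_convOp_sub_le [IsProbabilityMeasure μ] (hf : Continuous f) (hB : ∀ x, |f x| ≤ B)
    {δ η : ℝ} (hη : 0 ≤ η) (x : ℝ) (h : ∀ y, |y| ≤ δ → |f (x - y) - f x| ≤ η) :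
    |convOp μ f x - f x| ≤ η + 2 * B * μ.real {y | δ < |y|} := by
  have hB0 : 0 ≤ B := (abs_nonneg _).trans (hB 0)
  have hmeas : MeasurableSet {y : ℝ | δ < |y|} := measurableSet_lt measurable_const (by fun_prop)
  have h1 : convOp μ f x - f x = ∫ y, (f (x - y) - f x) ∂μ := by
    rw [integral_sub (integrable_comp_sub hf hB x) (integrable_const _)]
    simp [convOp]
  have hint : Integrable (fun y => η + Set.indicator {y : ℝ | δ < |y|} (fun _ => 2 * B) y) μ :=
    (integrable_const _).add ((integrable_const _).indicator hmeas)
  rw [h1]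
  have h2 : ‖∫ y, (f (x - y) - f x) ∂μ‖
      ≤ ∫ y, (η + Set.indicator {y : ℝ | δ < |y|} (fun _ => 2 * B) y) ∂μ := by
    refine norm_integral_le_of_norm_le hint (ae_of_all _ fun y => ?_)
    rw [Real.norm_eq_abs]
    by_cases hy : δ < |y|
    · rw [Set.indicator_of_mem (by exact hy)]
      have := (abs_sub (f (x - y)) (f x))
      linarith [hB (x - y), hB x]
    · rw [Set.indicator_of_notMem (by exact hy)]
      linarith [h y (not_lt.1 hy)]
  rw [Real.norm_eq_abs] at h2
  refine h2.trans_eq ?_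
  rw [integral_add (integrable_const _) ((integrable_const _).indicator hmeas),
    integral_indicator hmeas]
  simp [mul_comm]

/-- Uniformly continuous bounded functions are moved little by a law concentrated near `0`. -/
lemma exists_abs_convOp_sub_le (hf : UniformContinuous f) (hB : ∀ x, |f x| ≤ B) {η : ℝ}
    (hη : 0 < η) :
    ∃ δ > 0, ∃ θ > 0, ∀ μ : Measure ℝ, IsProbabilityMeasure μ →
      μ.real {y | δ < |y|} ≤ θ → ∀ x, |convOp μ f x - f x| ≤ η := by
  have hB0 : 0 ≤ B := (abs_nonneg _).trans (hB 0)
  obtain ⟨δ, hδ, h⟩ := Metric.uniformContinuous_iff.1 hf (η / 2) (by positivity)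
  -- Half of `η` is spent on `|y| ≤ δ/2`, the other half on the tail, where `2Bθ ≤ η/2`; `B + 1`
  -- avoids dividing by zero.
  refine ⟨δ / 2, by positivity, η / (4 * (B + 1)), by positivity, fun μ _ hμ x => ?_⟩
  refine (abs_convOp_sub_le (δ := δ / 2) (η := η / 2) hf.continuous hB (by positivity) x
    fun y hy => ?_).trans ?_
  · have := h (a := x - y) (b := x) (by rw [Real.dist_eq]; simp; linarith)
    rw [Real.dist_eq] at this
    exact this.le
  · have h1 : 2 * B * μ.real {y | δ / 2 < |y|} ≤ 2 * B * (η / (4 * (B + 1))) := by gcongr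
    have h2 : 2 * B * (η / (4 * (B + 1))) ≤ η / 2 := by
      rw [← mul_div_assoc, div_le_div_iff₀ (by positivity) (by positivity)]
      nlinarith
    linarith

/-- Tail estimate from a bound on the characteristic function near `0`. -/
lemma measureReal_abs_gt_le_of_charFun [IsProbabilityMeasure μ] {r b : ℝ} (hr : 0 < r)
    (h : ∀ k, |k| ≤ 2 / r → ‖1 - charFun μ k‖ ≤ b) : μ.real {y | r < |y|} ≤ 2 * b := by
  refine (measureReal_abs_gt_le_integral_charFun hr).trans ?_
  have h1 := intervalIntegral.norm_integral_le_of_norm_le_const (a := -2 * r⁻¹) (b := 2 * r⁻¹)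
    (f := fun t => 1 - charFun μ t) (C := b) (fun k hk => h k ?_)
  · calc 2⁻¹ * r * ‖∫ t in (-2 * r⁻¹)..(2 * r⁻¹), 1 - charFun μ t‖
        ≤ 2⁻¹ * r * (b * |2 * r⁻¹ - -2 * r⁻¹|) := by gcongr
      _ = 2 * b := by
        rw [abs_of_nonneg (by have : 0 < r⁻¹ := by positivity
                              linarith)]
        field_simp
        ring
  · have : 0 < r⁻¹ := by positivity
    rw [Set.uIoc_of_le (by linarith)] at hk
    rw [abs_le, div_eq_mul_inv]
    constructor <;> linarith [hk.1, hk.2]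

end ConvOp

/-- Convolution powers of a measure. -/
noncomputable def convPow (μ : Measure ℝ) : ℕ → Measure ℝ
  | 0 => Measure.dirac 0
  | n + 1 => (convPow μ n).conv μ

instance isProbabilityMeasure_convPow (μ : Measure ℝ) [IsProbabilityMeasure μ] (n : ℕ) :
    IsProbabilityMeasure (convPow μ n) := by
  induction n with
  | zero => exact Measure.dirac.isProbabilityMeasure
  | succ n ih =>
    rw [convPow]
    infer_instance

lemma charFun_convPow (μ : Measure ℝ) [IsProbabilityMeasure μ] (n : ℕ) (k : ℝ) :
    charFun (convPow μ n) k = charFun μ k ^ n := by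
  induction n with
  | zero => simp [convPow]
  | succ n ih => rw [convPow, charFun_conv, ih, pow_succ]

lemma norm_one_sub_pow_le {z : ℂ} (hz : ‖z‖ ≤ 1) (n : ℕ) : ‖1 - z ^ n‖ ≤ n * ‖1 - z‖ := by
  induction n with
  | zero => simp
  | succ n ih =>
    have : 1 - z ^ (n + 1) = (1 - z ^ n) + z ^ n * (1 - z) := by ring
    rw [this]
    refine (norm_add_le _ _).trans ?_
    rw [norm_mul, norm_pow]
    have : ‖z‖ ^ n * ‖1 - z‖ ≤ 1 * ‖1 - z‖ := by
      gcongr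
      exact pow_le_one₀ (norm_nonneg _) hz
    push_cast
    linarith

/-- Telescoping: comparison of `n` steps of a convolution operator with `n` Euler steps. -/
lemma abs_convPow_sub_sub_le {μ : Measure ℝ} [IsProbabilityMeasure μ] {f g : ℝ → ℝ}
    {B C h η η' : ℝ} (hf : Continuous f) (hB : ∀ x, |f x| ≤ B) (hg : Continuous g)
    (hC : ∀ x, |g x| ≤ C) (hh : 0 ≤ h)
    (h1 : ∀ x, |convOp μ f x - f x - h * g x| ≤ h * η) (n : ℕ)
    (h2 : ∀ j < n, ∀ x, |convOp (convPow μ j) g x - g x| ≤ η') (x : ℝ) :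
    |convOp (convPow μ n) f x - f x - n * h * g x| ≤ n * h * (η + η') := by
  induction n with
  | zero => simp [convPow]
  | succ n ih =>
    have hmf : Continuous (convOp μ f) := continuous_convOp hf hB
    have hmB : ∀ x, |convOp μ f x| ≤ B := abs_convOp_le hB
    have hhg : Continuous fun x => h * g x := by fun_prop
    have hhC : ∀ x, |h * g x| ≤ h * C := fun x => by
      rw [abs_mul, abs_of_nonneg hh]
      gcongr
      exact hC x
    have hd : Continuous fun x => convOp μ f x - f x := by fun_prop
    have hdB : ∀ x, |convOp μ f x - f x| ≤ B + B := fun x =>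
      (abs_sub _ _).trans (add_le_add (hmB x) (hB x))
    -- The local error of the last step is pushed through the first `n` steps, which are a
    -- contraction in sup norm.
    have e1 : convOp (convPow μ n) (fun z => convOp μ f z - f z - h * g z) x
        = convOp (convPow μ (n + 1)) f x - convOp (convPow μ n) f x
          - h * convOp (convPow μ n) g x := by
      rw [convOp_sub hd hdB hhg hhC, convOp_sub hmf hmB hf hB, convPow, convOp_conv hf hB,
        convOp_const_mul]
    have e2 := abs_convOp_le (μ := convPow μ n) h1 x
    have e3 := ih fun j hj => h2 j (by omega)
    have e4 := h2 n (by omega) x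
    rw [e1] at e2
    have e5 : |h * (convOp (convPow μ n) g x - g x)| ≤ h * η' := by
      rw [abs_mul, abs_of_nonneg hh]
      gcongr
    rw [abs_le] at *
    push_cast
    constructor <;> nlinarith

/-! ### Test functions -/

/-- A polynomial times a Gaussian. -/
noncomputable def polyGauss (b : ℝ) (p : Polynomial ℝ) (x : ℝ) : ℝ :=
  p.eval x * Real.exp (-b * x ^ 2)

lemma isC0_polyGauss {b : ℝ} (hb : 0 < b) (p : Polynomial ℝ) : IsC0 (polyGauss b p) := by
  refine ⟨by unfold polyGauss; fun_prop, ?_⟩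
  induction p using Polynomial.induction_on' with
  | add p q hp hq =>
    have := hp.add hq
    simp only [add_zero] at this
    refine this.congr fun x => ?_
    simp [polyGauss, add_mul]
  | monomial n a =>
    have h := (tendsto_rpow_abs_mul_exp_neg_mul_sq_cocompact hb n).const_mul |a|
    rw [mul_zero] at h
    refine squeeze_zero_norm (fun x => le_of_eq ?_) h
    simp [polyGauss, mul_assoc]

/-- Differentiation stays inside the class, so membership in `C₀²` and derivatives at `0` reduce to
polynomial algebra. -/
lemma hasDerivAt_polyGauss (b : ℝ) (p : Polynomial ℝ) (x : ℝ) :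
    HasDerivAt (polyGauss b p)
      (polyGauss b (p.derivative - Polynomial.C (2 * b) * Polynomial.X * p) x) x := by
  have h := (p.hasDerivAt x).mul (((hasDerivAt_pow 2 x).const_mul (-b)).exp)
  refine h.congr_deriv ?_
  simp [polyGauss]
  ring

lemma deriv_polyGauss (b : ℝ) (p : Polynomial ℝ) :
    deriv (polyGauss b p)
      = polyGauss b (p.derivative - Polynomial.C (2 * b) * Polynomial.X * p) :=
  funext fun x => (hasDerivAt_polyGauss b p x).deriv

lemma isC02_polyGauss {b : ℝ} (hb : 0 < b) (p : Polynomial ℝ) : IsC02 (polyGauss b p) := by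
  refine ⟨ContDiff.mul (by simpa using p.contDiff_aeval (𝕜 := ℝ) 2) (by fun_prop), isC0_polyGauss hb _, ?_, ?_⟩
  · rw [deriv_polyGauss]
    exact isC0_polyGauss hb _
  · rw [deriv_polyGauss, deriv_polyGauss]
    exact isC0_polyGauss hb _

lemma IsC0.exists_bound {f : ℝ → ℝ} (hf : IsC0 f) : ∃ B, 0 ≤ B ∧ ∀ x, |f x| ≤ B := by
  let F : ZeroAtInftyContinuousMap ℝ ℝ := ⟨⟨f, hf.1⟩, hf.2⟩
  refine ⟨‖F.toBCF‖, norm_nonneg _, fun x => F.toBCF.norm_coe_le_norm x⟩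

lemma IsC0.uniformContinuous {f : ℝ → ℝ} (hf : IsC0 f) : UniformContinuous f :=
  hf.1.uniformContinuous_of_tendsto_cocompact hf.2

/-! ### Convolution with a Gaussian law -/

/-- Tonelli together with translation invariance of Lebesgue measure. -/
lemma conv_withDensity {μ : Measure ℝ} [IsProbabilityMeasure μ] {g : ℝ → ℝ} {B : ℝ}
    (hg : Continuous g) (h0 : ∀ x, 0 ≤ g x) (hB : ∀ x, |g x| ≤ B)
    [IsFiniteMeasure (volume.withDensity fun x => ENNReal.ofReal (g x))] :
    μ.conv (volume.withDensity fun x => ENNReal.ofReal (g x))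
      = volume.withDensity fun x => ENNReal.ofReal (convOp μ g x) := by
  have hm : Measurable fun x => ENNReal.ofReal (g x) := by fun_prop
  ext s hs
  rw [withDensity_apply _ hs, ← lintegral_indicator_one hs,
    Measure.lintegral_conv (measurable_one.indicator hs)]
  calc ∫⁻ x, ∫⁻ y, s.indicator 1 (x + y) ∂(volume.withDensity fun x => ENNReal.ofReal (g x)) ∂μ
      = ∫⁻ x, ∫⁻ y, ENNReal.ofReal (g (y - x)) * s.indicator 1 y ∂volume ∂μ := by
        refine lintegral_congr fun x => ?_
        have h := lintegral_withDensity_eq_lintegral_mul volume hm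
          ((measurable_one.indicator hs).comp (measurable_const_add x) :
            Measurable fun y => s.indicator (1 : ℝ → ℝ≥0∞) (x + y))
        refine h.trans ?_
        rw [← lintegral_add_left_eq_self
          (fun y => ENNReal.ofReal (g (y - x)) * s.indicator 1 y) x]
        simp
    _ = ∫⁻ y, ∫⁻ x, ENNReal.ofReal (g (y - x)) * s.indicator 1 y ∂μ ∂volume := by
        refine lintegral_lintegral_swap (Measurable.aemeasurable ?_)
        refine Measurable.mul (by fun_prop) ?_
        exact (measurable_one.indicator hs).comp measurable_snd
    _ = ∫⁻ y, s.indicator (fun y => ENNReal.ofReal (convOp μ g y)) y := by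
        refine lintegral_congr fun y => ?_
        rw [lintegral_mul_const _ (by fun_prop)]
        have e : ENNReal.ofReal (convOp μ g y) = ∫⁻ x, ENNReal.ofReal (g (y - x)) ∂μ :=
          ofReal_integral_eq_lintegral_ofReal (integrable_comp_sub hg hB y)
            (ae_of_all _ fun x => h0 _)
        by_cases hy : y ∈ s <;> simp [hy, e]
    _ = ∫⁻ y in s, ENNReal.ofReal (convOp μ g y) := lintegral_indicator hs _

lemma gaussianPDFReal_zero_eq_polyGauss (v : ℝ≥0) :
    gaussianPDFReal 0 v = polyGauss (1 / (2 * v)) (Polynomial.C (√(2 * Real.pi * v))⁻¹) := by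
  ext x
  simp only [gaussianPDFReal, polyGauss, Polynomial.eval_C, sub_zero]
  congr 2
  ring

lemma isC02_gaussianPDFReal {v : ℝ≥0} (hv : v ≠ 0) : IsC02 (gaussianPDFReal 0 v) := by
  rw [gaussianPDFReal_zero_eq_polyGauss]
  have : 0 < v := pos_iff_ne_zero.2 hv
  exact isC02_polyGauss (by positivity) _

lemma conv_gaussianReal (μ : Measure ℝ) [IsProbabilityMeasure μ] {v : ℝ≥0} (hv : v ≠ 0) :
    μ.conv (gaussianReal 0 v)
      = volume.withDensity fun x => ENNReal.ofReal (convOp μ (gaussianPDFReal 0 v) x) := by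
  obtain ⟨B, -, hB⟩ := (isC02_gaussianPDFReal hv).2.1.exists_bound
  have h : gaussianReal 0 v = volume.withDensity fun x => ENNReal.ofReal (gaussianPDFReal 0 v x) :=
    gaussianReal_of_var_ne_zero 0 hv
  have : IsFiniteMeasure (volume.withDensity fun x => ENNReal.ofReal (gaussianPDFReal 0 v x)) := by
    rw [← h]
    infer_instance
  rw [h]
  exact conv_withDensity (isC02_gaussianPDFReal hv).2.1.1 (gaussianPDFReal_nonneg 0 v) hB

lemma hasStrictlyPositiveDensity_conv_gaussianReal (μ : Measure ℝ) [IsProbabilityMeasure μ]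
    {v : ℝ≥0} (hv : v ≠ 0) : HasStrictlyPositiveDensity (μ.conv (gaussianReal 0 v)) := by
  obtain ⟨B, -, hB⟩ := (isC02_gaussianPDFReal hv).2.1.exists_bound
  have hc := (isC02_gaussianPDFReal hv).2.1.1
  refine ⟨_, continuous_convOp hc hB, fun x => ?_, conv_gaussianReal μ hv⟩
  refine (integral_pos_iff_support_of_nonneg (fun y => gaussianPDFReal_nonneg 0 v _)
    (integrable_comp_sub hc hB x)).2 ?_
  have : Function.support (fun y => gaussianPDFReal 0 v (x - y)) = Set.univ :=
    Set.eq_univ_of_forall fun y => (gaussianPDFReal_pos 0 v _ hv).ne'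
  rw [this]
  simp

/-! ### Uniqueness of the heat kernel -/

/-- Steps are exchanged one at a time: convolutions commute and are sup-norm contractions, so each
exchange costs at most `η`. -/
lemma abs_convPow_sub_convPow_le {μ ν : Measure ℝ} [IsProbabilityMeasure μ]
    [IsProbabilityMeasure ν] {f : ℝ → ℝ} {B η : ℝ} (hf : Continuous f) (hB : ∀ x, |f x| ≤ B)
    (h : ∀ x, |convOp μ f x - convOp ν f x| ≤ η) (n : ℕ) (x : ℝ) :
    |convOp (convPow μ n) f x - convOp (convPow ν n) f x| ≤ n * η := by
  induction n generalizing x with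
  | zero => simp [convPow]
  | succ n ih =>
    have e1 : convOp (convPow μ (n + 1)) f x - convOp (convPow ν (n + 1)) f x
        = convOp (convPow μ n) (fun z => convOp μ f z - convOp ν f z) x
          + convOp ν (fun z => convOp (convPow μ n) f z - convOp (convPow ν n) f z) x := by
      rw [convOp_sub (continuous_convOp hf hB) (abs_convOp_le hB) (continuous_convOp hf hB)
        (abs_convOp_le hB), convOp_sub (continuous_convOp hf hB) (abs_convOp_le hB)
        (continuous_convOp hf hB) (abs_convOp_le hB), ← convOp_conv hf hB, ← convOp_conv hf hB,
        ← convOp_conv hf hB, ← convOp_conv hf hB, Measure.conv_comm ν (convPow μ n),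
        Measure.conv_comm ν (convPow ν n)]
      simp [convPow]
    rw [e1]
    refine (abs_add_le _ _).trans ?_
    have h1 := abs_convOp_le (μ := convPow μ n) h x
    have h2 := abs_convOp_le (μ := ν) ih x
    push_cast
    linarith

lemma IsConvolutionSemigroup.convPow_eq {p : ℝ≥0 → Measure ℝ} (hp : IsConvolutionSemigroup p)
    (t : ℝ≥0) (n : ℕ) : convPow (p t) n = p (n * t) := by
  induction n with
  | zero => simp [convPow, hp.zero]
  | succ n ih => rw [convPow, ih, ← hp.add]; congr 1; push_cast; ring

/-- Over a step `s = t/(n+1)` both semigroups equal `f + s L f` up to `o(s)`; the `n+1` errors add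
up to `o(1)`. Hence they agree on `C₀²`, which contains enough functions to determine the measures.
-/
lemma IsHeatKernel.unique {L : (ℝ → ℝ) → ℝ → ℝ} {p q : ℝ≥0 → Measure ℝ}
    (hp : IsHeatKernel L p) (hq : IsHeatKernel L q) : q = p := by
  have ip := hp.semigroup.isProbabilityMeasure
  have iq := hq.semigroup.isProbabilityMeasure
  have key : ∀ f : ℝ → ℝ, IsC02 f → ∀ t x, convOp (p t) f x = convOp (q t) f x := by
    intro f hf t x
    obtain ⟨B, -, hB⟩ := hf.2.1.exists_bound
    rcases eq_or_ne t 0 with rfl | ht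
    · rw [hp.semigroup.zero, hq.semigroup.zero]
    have ht' : 0 < t := pos_iff_ne_zero.2 ht
    rw [← sub_eq_zero, ← abs_nonpos_iff]
    refine le_of_forall_pos_le_add fun ε hε => ?_
    have e1 := Metric.tendstoUniformly_iff.1 (hp.generator f hf) (ε / (2 * t)) (by positivity)
    have e2 := Metric.tendstoUniformly_iff.1 (hq.generator f hf) (ε / (2 * t)) (by positivity)
    have hlim : Tendsto (fun n : ℕ => t / ((n : ℝ≥0) + 1)) atTop (𝓝[>] 0) := by
      refine tendsto_nhdsWithin_iff.2 ⟨?_, Eventually.of_forall fun n => ?_⟩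
      · have h := tendsto_one_div_add_atTop_nhds_zero_nat (𝕜 := ℝ≥0)
        simpa [div_eq_mul_inv] using h.const_mul t
      · exact div_pos ht' (by positivity)
    obtain ⟨n, h1, h2⟩ := (hlim.eventually (e1.and e2)).exists
    set s : ℝ≥0 := t / ((n : ℝ≥0) + 1) with hs
    have hs0 : 0 < s := div_pos ht' (by positivity)
    have hns : ((n + 1 : ℕ) : ℝ≥0) * s = t := by
      rw [hs]
      push_cast
      field_simp
    have hns' : ((n + 1 : ℕ) : ℝ) * s = t := by exact_mod_cast congrArg NNReal.toReal hns
    have hb : ∀ y, |convOp (p s) f y - convOp (q s) f y| ≤ s * (ε / t) := by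
      intro y
      have d1 := h1 y
      have d2 := h2 y
      rw [Real.dist_eq] at d1 d2
      have hsr : (0 : ℝ) < s := hs0
      have e : convOp (p s) f y - convOp (q s) f y
          = s * ((L f y - ((∫ z, f (y - z) ∂q s) - f y) / s)
            - (L f y - ((∫ z, f (y - z) ∂p s) - f y) / s)) := by
        unfold convOp
        field_simp
        ring
      rw [e, abs_mul, abs_of_pos hsr]
      gcongr
      refine (abs_sub _ _).trans ?_
      have : ε / t = ε / (2 * t) + ε / (2 * t) := by field_simp; ring
      linarith
    have h3 := abs_convPow_sub_convPow_le hf.2.1.1 hB hb (n + 1) x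
    rw [hp.semigroup.convPow_eq, hq.semigroup.convPow_eq, hns] at h3
    refine h3.trans (le_of_eq ?_)
    rw [← mul_assoc, hns', zero_add]
    field_simp
  funext t
  -- Testing against the Gaussian density suffices: the Gaussian characteristic function never
  -- vanishes and can be cancelled.
  have h1 : (q t).conv (gaussianReal 0 1) = (p t).conv (gaussianReal 0 1) := by
    rw [conv_gaussianReal _ one_ne_zero, conv_gaussianReal _ one_ne_zero]
    congr 1
    ext x
    rw [key _ (isC02_gaussianPDFReal one_ne_zero)]
  refine Measure.ext_of_charFun (funext fun k => ?_)
  have h2 := congrArg (fun m => charFun m k) h1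
  simp only [charFun_conv] at h2
  refine mul_right_cancel₀ ?_ h2
  rw [charFun_gaussianReal]
  exact Complex.exp_ne_zero _

/-! ### The Lévy density of the Caputo derivative -/

/-- The density `α / Γ(1-α) u^{-α-1}`. -/
noncomputable def caputoDensity (α u : ℝ) : ℝ := α / Real.Gamma (1 - α) * u ^ (-α - 1)

section Density

variable {α : ℝ} {E : Type*} [NormedAddCommGroup E] [NormedSpace ℝ E]

lemma caputoDensity_pos (hα₀ : 0 < α) (hα₁ : α < 1) {u : ℝ} (hu : 0 < u) :
    0 < caputoDensity α u := by
  have : 0 < Real.Gamma (1 - α) := Real.Gamma_pos_of_pos (by linarith)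
  unfold caputoDensity
  positivity

lemma measurable_caputoDensity : Measurable (caputoDensity α) := by
  unfold caputoDensity
  fun_prop

lemma mul_caputoDensity {u : ℝ} (hu : 0 < u) :
    u * caputoDensity α u = α / Real.Gamma (1 - α) * u ^ (-α) := by
  unfold caputoDensity
  rw [show -α - 1 = -α + (-1) by ring, Real.rpow_add hu, Real.rpow_neg_one]
  field_simp

/-- Near `0` the integrand is of order `u^(-α)`, integrable since `α < 1`; at infinity it is of
order `u^(-α-1)`, integrable since `α > 0`. All later estimates are measured against this weight. -/
lemma integrableOn_min_mul_caputoDensity (hα₀ : 0 < α) (hα₁ : α < 1) :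
    IntegrableOn (fun u => min 1 u * caputoDensity α u) (Set.Ioi 0) := by
  rw [← Set.Ioc_union_Ioi_eq_Ioi zero_le_one]
  refine IntegrableOn.union ?_ ?_
  · have h : IntegrableOn (fun u : ℝ => α / Real.Gamma (1 - α) * u ^ (-α)) (Set.Ioc 0 1) := by
      have := (intervalIntegral.intervalIntegrable_rpow' (a := 0) (b := 1)
        (show -1 < -α by linarith)).const_mul (α / Real.Gamma (1 - α))
      rwa [intervalIntegrable_iff_integrableOn_Ioc_of_le zero_le_one] at this
    refine h.congr_fun (fun u hu => ?_) measurableSet_Ioc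
    simp only
    rw [min_eq_right hu.2, mul_caputoDensity hu.1]
  · have h := (integrableOn_Ioi_rpow_of_lt (a := -α - 1) (c := 1) (by linarith)
      one_pos).const_mul (α / Real.Gamma (1 - α))
    refine IntegrableOn.congr_fun h (fun u hu => ?_) measurableSet_Ioi
    rw [min_eq_left (le_of_lt hu), one_mul, caputoDensity]

lemma integrableOn_caputoDensity_smul (hα₀ : 0 < α) (hα₁ : α < 1) {F : ℝ → E} {K : ℝ}
    (hF : Continuous F) (hK : ∀ u, 0 < u → ‖F u‖ ≤ K * min 1 u) :
    IntegrableOn (fun u => caputoDensity α u • F u) (Set.Ioi 0) := by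
  refine Integrable.mono' ((integrableOn_min_mul_caputoDensity hα₀ hα₁).const_mul K)
    (measurable_caputoDensity.aestronglyMeasurable.smul hF.aestronglyMeasurable) ?_
  refine (ae_restrict_iff' measurableSet_Ioi).2 (ae_of_all _ fun u hu => ?_)
  have h0 := caputoDensity_pos hα₀ hα₁ hu
  rw [norm_smul, Real.norm_eq_abs, abs_of_pos h0]
  nlinarith [hK u hu]

lemma le_mul_min_one {a b K u : ℝ} (h1 : a ≤ b) (h2 : a ≤ K * u) (hu : 0 < u) :
    a ≤ max b K * min 1 u := by
  rcases le_total 1 u with h | h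
  · rw [min_eq_left h, mul_one]
    exact h1.trans (le_max_left _ _)
  · rw [min_eq_right h]
    exact h2.trans (by gcongr; exact le_max_right _ _)

end Density

/-! ### The exponent -/

lemma norm_exp_sub_one_le_of_re_nonpos {z : ℂ} (hz : z.re ≤ 0) :
    ‖Complex.exp z - 1‖ ≤ ‖z‖ := by
  have hc : Convex ℝ {z : ℂ | z.re ≤ 0} := convex_halfSpace_re_le 0
  have := hc.norm_image_sub_le_of_norm_hasDerivWithin_le (f := Complex.exp) (f' := Complex.exp)
    (C := 1) (x := 0) (y := z) (fun w _ => (Complex.hasDerivAt_exp w).hasDerivWithinAt)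
    (fun w hw => by rw [Complex.norm_exp]; exact Real.exp_le_one_iff.2 hw) (by simp) hz
  simpa using this

lemma norm_exp_sub_one_le_two {z : ℂ} (hz : z.re ≤ 0) : ‖Complex.exp z - 1‖ ≤ 2 := by
  refine (norm_sub_le _ _).trans ?_
  rw [Complex.norm_exp, norm_one]
  linarith [Real.exp_le_one_iff.2 hz]

lemma norm_exp_neg_mul_sub_one_le {z : ℂ} (hz : 0 ≤ z.re) {R : ℝ} (hR : ‖z‖ ≤ R) {u : ℝ}
    (hu : 0 < u) : ‖Complex.exp (-z * u) - 1‖ ≤ max 2 R * min 1 u := by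
  have h : (-z * u).re ≤ 0 := by
    simp only [Complex.mul_re, Complex.neg_re, Complex.ofReal_re, Complex.ofReal_im, mul_zero,
      sub_zero]
    nlinarith
  refine le_mul_min_one (norm_exp_sub_one_le_two h)
    ((norm_exp_sub_one_le_of_re_nonpos h).trans ?_) hu
  rw [norm_mul, norm_neg, Complex.norm_real, Real.norm_eq_abs, abs_of_pos hu]
  gcongr

/-- The Laplace exponent of the one-sided stable law. -/
noncomputable def laplaceExponent (α : ℝ) (z : ℂ) : ℂ :=
  ∫ u in Set.Ioi (0 : ℝ), caputoDensity α u • (Complex.exp (-z * u) - 1)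

section Exponent

variable {α : ℝ}

lemma continuousOn_laplaceExponent (hα₀ : 0 < α) (hα₁ : α < 1) :
    ContinuousOn (laplaceExponent α) {z | 0 ≤ z.re} := by
  intro z₀ _
  refine continuousWithinAt_of_dominated
    (bound := fun u => max 2 (‖z₀‖ + 1) * (min 1 u * caputoDensity α u)) ?_ ?_
    ((integrableOn_min_mul_caputoDensity hα₀ hα₁).const_mul _) ?_
  · exact Eventually.of_forall fun z => measurable_caputoDensity.aestronglyMeasurable.smul
      (Continuous.aestronglyMeasurable (by fun_prop))
  · have h1 : ∀ᶠ z in 𝓝[{z : ℂ | 0 ≤ z.re}] z₀, ‖z‖ ≤ ‖z₀‖ + 1 :=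
      nhdsWithin_le_nhds ((continuous_norm.tendsto z₀).eventually_le_const (by linarith))
    filter_upwards [h1, self_mem_nhdsWithin] with z hz hz'
    refine (ae_restrict_iff' measurableSet_Ioi).2 (ae_of_all _ fun u hu => ?_)
    have h0 := caputoDensity_pos hα₀ hα₁ hu
    rw [norm_smul, Real.norm_eq_abs, abs_of_pos h0]
    have := norm_exp_neg_mul_sub_one_le hz' hz hu
    nlinarith
  · exact ae_of_all _ fun u => Continuous.continuousWithinAt (by fun_prop)

/-- Differentiation under the integral. On `Re z > Re z₀ / 2` the derivative is dominated by a
multiple of `u^(-α) exp(-(Re z₀/2) u)`. -/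
lemma hasDerivAt_laplaceExponent (hα₀ : 0 < α) (hα₁ : α < 1) {z₀ : ℂ} (hz : 0 < z₀.re) :
    HasDerivAt (laplaceExponent α)
      (∫ u in Set.Ioi (0 : ℝ), caputoDensity α u • (Complex.exp (-z₀ * u) * -u)) z₀ := by
  have hs : {z : ℂ | z₀.re / 2 < z.re} ∈ 𝓝 z₀ :=
    (isOpen_lt continuous_const Complex.continuous_re).mem_nhds (by simp; linarith)
  have hint : IntegrableOn (fun u : ℝ => α / Real.Gamma (1 - α)
      * (u ^ (-α) * Real.exp (-(z₀.re / 2) * u))) (Set.Ioi 0) :=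
    (integrableOn_rpow_mul_exp_neg_mul_rpow (s := -α) (p := 1) (b := z₀.re / 2) (by linarith)
      one_pos (by linarith)).congr_fun (fun u _ => by simp) measurableSet_Ioi |>.const_mul _
  refine (hasDerivAt_integral_of_dominated_loc_of_deriv_le (𝕜 := ℂ)
    (F := fun z (u : ℝ) => caputoDensity α u • (Complex.exp (-z * u) - 1))
    (F' := fun z (u : ℝ) => caputoDensity α u • (Complex.exp (-z * u) * -u)) hs
    (Eventually.of_forall fun z => measurable_caputoDensity.aestronglyMeasurable.smul
      (Continuous.aestronglyMeasurable (by fun_prop))) ?_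
    (measurable_caputoDensity.aestronglyMeasurable.smul
      (Continuous.aestronglyMeasurable (by fun_prop))) ?_ hint ?_).2
  · exact integrableOn_caputoDensity_smul hα₀ hα₁ (by fun_prop)
      fun u hu => norm_exp_neg_mul_sub_one_le hz.le le_rfl hu
  · refine (ae_restrict_iff' measurableSet_Ioi).2 (ae_of_all _ fun u hu z hz' => ?_)
    have h0 := caputoDensity_pos hα₀ hα₁ hu
    have hu' : (0 : ℝ) < u := hu
    rw [norm_smul, Real.norm_eq_abs, abs_of_pos h0, norm_mul, norm_neg, Complex.norm_real,
      Real.norm_eq_abs, abs_of_pos hu', Complex.norm_exp, ← mul_assoc (α / _),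
      ← mul_caputoDensity hu]
    have h1 : (-z * u).re ≤ -(z₀.re / 2) * u := by
      simp only [Complex.mul_re, Complex.neg_re, Complex.ofReal_re, Complex.ofReal_im, mul_zero,
        sub_zero]
      have : z₀.re / 2 < z.re := hz'
      nlinarith
    have h2 := Real.exp_le_exp.2 h1
    have h3 : 0 < u * caputoDensity α u := mul_pos hu' h0
    nlinarith
  · refine (ae_of_all _ fun u z _ => HasDerivAt.fun_const_smul _ (HasDerivAt.sub_const _ ?_))
    have := ((hasDerivAt_id z).neg.mul_const (u : ℂ)).cexp
    simpa using this

/-- The integral is `∫ u^(-α) e^(-su) du = Γ(1-α) s^(α-1)`; the normalisation of the Caputo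
derivative cancels the Gamma factor. -/
lemma deriv_laplaceExponent_ofReal (hα₀ : 0 < α) (hα₁ : α < 1) {s : ℝ} (hs : 0 < s) :
    deriv (laplaceExponent α) s = -(α * (s : ℂ) ^ ((α : ℂ) - 1)) := by
  have hG : Real.Gamma (1 - α) ≠ 0 := (Real.Gamma_pos_of_pos (by linarith)).ne'
  rw [(hasDerivAt_laplaceExponent hα₀ hα₁ (z₀ := s) (by simpa using hs)).deriv]
  have h := Real.integral_rpow_mul_exp_neg_mul_Ioi (a := 1 - α) (r := s) (by linarith) hs
  have e : ∫ u in Set.Ioi (0 : ℝ), caputoDensity α u • (Complex.exp (-(s : ℂ) * u) * -u)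
      = ∫ u in Set.Ioi (0 : ℝ), ((-(α / Real.Gamma (1 - α)) *
        (u ^ (1 - α - 1) * Real.exp (-(s * u))) : ℝ) : ℂ) := by
    refine setIntegral_congr_fun measurableSet_Ioi fun u hu => ?_
    have h1 := mul_caputoDensity (α := α) hu
    simp only [Complex.real_smul]
    have h2 : (1 : ℝ) - α - 1 = -α := by ring
    rw [h2]
    calc (caputoDensity α u : ℂ) * (Complex.exp (-(s : ℂ) * u) * -u)
        = ((-(u * caputoDensity α u) * Real.exp (-(s * u)) : ℝ) : ℂ) := by
          push_cast
          rw [neg_mul (s : ℂ)]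
          ring
      _ = _ := by rw [h1]; push_cast; ring
  rw [e, integral_complex_ofReal, integral_const_mul, h]
  have h3 : (s : ℂ) ^ ((α : ℂ) - 1) = ((s ^ (α - 1) : ℝ) : ℂ) := by
    rw [Complex.ofReal_cpow hs.le]
    push_cast
    rfl
  rw [h3, one_div, Real.inv_rpow hs.le, ← Real.rpow_neg hs.le, neg_sub]
  norm_cast
  field_simp

lemma eqOn_deriv_laplaceExponent (hα₀ : 0 < α) (hα₁ : α < 1) :
    Set.EqOn (deriv (laplaceExponent α)) (fun z => -(α * z ^ ((α : ℂ) - 1))) {z | 0 < z.re} := by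
  have ho : IsOpen {z : ℂ | 0 < z.re} := isOpen_lt continuous_const Complex.continuous_re
  have hd : DifferentiableOn ℂ (laplaceExponent α) {z | 0 < z.re} := fun z hz =>
    (hasDerivAt_laplaceExponent hα₀ hα₁ hz).differentiableAt.differentiableWithinAt
  have h2 : DifferentiableOn ℂ (fun z : ℂ => -(α * z ^ ((α : ℂ) - 1))) {z | 0 < z.re} := by
    intro z hz
    refine DifferentiableAt.differentiableWithinAt ?_
    refine ((differentiableAt_id.cpow_const (Or.inl hz)).const_mul _).neg
  refine AnalyticOnNhd.eqOn_of_preconnected_of_frequently_eq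
    ((hd.analyticOnNhd ho).deriv) (h2.analyticOnNhd ho)
    (convex_halfSpace_re_gt 0).isPreconnected (z₀ := 1) (by simp) ?_
  -- The identity theorem needs agreement only along real points accumulating at `1`.
  have ht : Tendsto (fun n : ℕ => (((1 + 1 / ((n : ℝ) + 1)) : ℝ) : ℂ)) atTop (𝓝[≠] 1) := by
    refine tendsto_nhdsWithin_iff.2 ⟨?_, Eventually.of_forall fun n => ?_⟩
    · have := (tendsto_one_div_add_atTop_nhds_zero_nat (𝕜 := ℝ)).const_add 1
      rw [add_zero] at this
      exact (Complex.continuous_ofReal.tendsto' 1 1 Complex.ofReal_one).comp this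
    · have h : 1 / ((n : ℝ) + 1) ≠ 0 := by positivity
      simp only [Set.mem_compl_iff, Set.mem_singleton_iff]
      norm_cast
      simpa using h
  refine ht.frequently (Frequently.of_forall fun n => ?_)
  exact deriv_laplaceExponent_ofReal hα₀ hα₁ (by positivity)

/-- Both sides have the same derivative on the open half-plane, so they differ by a constant.
Continuity extends this to the imaginary axis, and the value at `0` shows that the constant is zero.
-/
lemma laplaceExponent_eq (hα₀ : 0 < α) (hα₁ : α < 1) {z : ℂ} (hz : 0 ≤ z.re) :
    laplaceExponent α z = -z ^ (α : ℂ) := by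
  have ho : IsOpen {z : ℂ | 0 < z.re} := isOpen_lt continuous_const Complex.continuous_re
  have hcont : ContinuousOn (fun z => laplaceExponent α z + z ^ (α : ℂ)) {z | 0 ≤ z.re} := by
    refine (continuousOn_laplaceExponent hα₀ hα₁).add fun w hw => ?_
    refine (Complex.continuousAt_cpow_const_of_re_pos (Or.inl hw)
      (by simpa using hα₀)).continuousWithinAt
  have hderiv : ∀ w ∈ {z : ℂ | 0 < z.re},
      HasDerivAt (fun z => laplaceExponent α z + z ^ (α : ℂ)) 0 w := by
    intro w hw
    have h1 := (hasDerivAt_laplaceExponent hα₀ hα₁ hw).differentiableAt.hasDerivAt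
    rw [eqOn_deriv_laplaceExponent hα₀ hα₁ hw] at h1
    have h2 := (hasDerivAt_id w).cpow_const (c := (α : ℂ)) (Or.inl hw)
    refine (h1.add h2).congr_deriv ?_
    simp
  obtain ⟨a, ha⟩ := ho.exists_is_const_of_deriv_eq_zero (convex_halfSpace_re_gt 0).isPreconnected
    (fun w hw => (hderiv w hw).differentiableAt.differentiableWithinAt)
    (fun w hw => (hderiv w hw).deriv)
  have hcl : {z : ℂ | 0 ≤ z.re} ⊆ closure {z : ℂ | 0 < z.re} := by
    rw [Complex.closure_setOfPred_lt_re]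
  have hall : ∀ w ∈ {z : ℂ | 0 ≤ z.re}, laplaceExponent α w + w ^ (α : ℂ) = a := by
    have := Set.EqOn.of_subset_closure (s := {z : ℂ | 0 < z.re}) (t := {z : ℂ | 0 ≤ z.re})
      (f := fun z => laplaceExponent α z + z ^ (α : ℂ)) (g := fun _ => a) (fun w hw => ha w hw)
      hcont continuousOn_const (fun w (hw : 0 < w.re) => hw.le) hcl
    exact this
  have h0 := hall 0 (by simp)
  rw [Complex.zero_cpow (by exact_mod_cast hα₀.ne')] at h0
  have h00 : laplaceExponent α 0 = 0 := by simp [laplaceExponent]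
  rw [h00] at h0
  have := hall z hz
  rw [← h0] at this
  linear_combination this

/-- For `k ≠ 0` the principal argument of `-ik` is `-sgn(k) π/2`, which is the source of the phase
with `θ = -α`. -/
lemma laplaceExponent_neg_mul_I (hα₀ : 0 < α) (hα₁ : α < 1) (k : ℝ) :
    laplaceExponent α (-(k * Complex.I)) = rieszFellerSymbol α (-α) k := by
  have key : ∀ (r : ℝ) (w : ℂ), 0 < r → w ≠ 0 →
      ((r : ℂ) * w) ^ (α : ℂ) = ((r ^ α : ℝ) : ℂ) * Complex.exp (Complex.log w * α) := by
    intro r w hr hw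
    have hr' : (r : ℂ) ≠ 0 := by exact_mod_cast hr.ne'
    rw [Complex.cpow_def_of_ne_zero (mul_ne_zero hr' hw), Complex.log_ofReal_mul hr hw, add_mul,
      Complex.exp_add, Complex.ofReal_cpow hr.le, Complex.cpow_def_of_ne_zero hr',
      Complex.ofReal_log hr.le]
  rw [laplaceExponent_eq hα₀ hα₁ (by simp), rieszFellerSymbol]
  rcases lt_trichotomy k 0 with hk | rfl | hk
  · have hp : -(k * Complex.I) = ((-k : ℝ) : ℂ) * Complex.I := by push_cast; ring
    rw [hp, key _ _ (by linarith) Complex.I_ne_zero, Complex.log_I, abs_of_neg hk, sign_neg hk,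
      neg_mul]
    congr 3
    have hs : ((-1 : SignType) : ℝ) = -1 := by simp
    rw [hs]
    push_cast
    ring
  · simp [hα₀.ne']
  · have hp : -(k * Complex.I) = (k : ℂ) * -Complex.I := by ring
    rw [hp, key _ _ hk (neg_ne_zero.2 Complex.I_ne_zero), Complex.log_neg_I, abs_of_pos hk,
      sign_pos hk, neg_mul]
    have hs : ((1 : SignType) : ℝ) = 1 := by simp
    rw [hs]
    push_cast
    ring_nf

/-- The Lévy–Khintchine representation of the symbol `ψ`. -/
lemma integral_caputoDensity_smul_exp_sub_one (hα₀ : 0 < α) (hα₁ : α < 1) (k : ℝ) :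
    ∫ u in Set.Ioi (0 : ℝ), caputoDensity α u • (Complex.exp (k * u * Complex.I) - 1)
      = rieszFellerSymbol α (-α) k := by
  rw [← laplaceExponent_neg_mul_I hα₀ hα₁, laplaceExponent]
  refine integral_congr_ae (ae_of_all _ fun u => ?_)
  simp only
  congr 3
  ring

end Exponent

/-! ### Pareto steps -/

/-- The scale of the Pareto law with Lévy density `h * caputoDensity α`. -/
noncomputable def stepScale (α h : ℝ) : ℝ := (h / Real.Gamma (1 - α)) ^ (1 / α)

/-- The Pareto law with density `h * caputoDensity α` on `[stepScale α h, ∞)`. -/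
noncomputable def paretoStep (α h : ℝ) : Measure ℝ := paretoMeasure (stepScale α h) α

/-- The mass of `min 1 u * caputoDensity α u` on `(0, stepScale α h]`. -/
noncomputable def stepError (α h : ℝ) : ℝ :=
  ∫ u in Set.Ioc 0 (stepScale α h), min 1 u * caputoDensity α u

/-- The total mass of `min 1 u * caputoDensity α u`. -/
noncomputable def caputoMass (α : ℝ) : ℝ :=
  ∫ u in Set.Ioi (0 : ℝ), min 1 u * caputoDensity α u

section Step

variable {α : ℝ} {E : Type*} [NormedAddCommGroup E] [NormedSpace ℝ E]

lemma stepScale_pos (hα₁ : α < 1) {h : ℝ} (hh : 0 < h) : 0 < stepScale α h :=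
  Real.rpow_pos_of_pos (div_pos hh (Real.Gamma_pos_of_pos (by linarith))) _

lemma isProbabilityMeasure_paretoStep (hα₀ : 0 < α) (hα₁ : α < 1) {h : ℝ} (hh : 0 < h) :
    IsProbabilityMeasure (paretoStep α h) :=
  isProbabilityMeasure_paretoMeasure (stepScale_pos hα₁ hh) hα₀

lemma tendsto_stepScale (hα₀ : 0 < α) : Tendsto (stepScale α) (𝓝 0) (𝓝 0) := by
  -- Real powers with nonnegative exponent are continuous even through their default values at
  -- negative arguments, so the limit may be two-sided.
  have h : Continuous (stepScale α) := by
    unfold stepScale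
    exact Continuous.rpow_const (by fun_prop) fun x => Or.inr (by positivity)
  refine h.tendsto' 0 0 ?_
  rw [stepScale, zero_div, Real.zero_rpow (by positivity)]

lemma tendsto_stepError (hα₀ : 0 < α) (hα₁ : α < 1) : Tendsto (stepError α) (𝓝 0) (𝓝 0) := by
  have h1 : ∀ h, stepError α h = ∫ u in Set.Ioc 0 (stepScale α h),
      min 1 u * caputoDensity α u ∂(volume.restrict (Set.Ioi 0)) := fun h => by
    rw [stepError, Measure.restrict_restrict measurableSet_Ioc, Set.inter_eq_left.2
      fun u hu => hu.1]
  refine Tendsto.congr (fun h => (h1 h).symm) ?_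
  refine (integrableOn_min_mul_caputoDensity hα₀ hα₁).tendsto_setIntegral_nhds_zero ?_
  refine tendsto_of_tendsto_of_tendsto_of_le_of_le tendsto_const_nhds
    (h := fun h => ENNReal.ofReal (stepScale α h)) ?_ (fun _ => zero_le) fun h => ?_
  · have := ENNReal.tendsto_ofReal (tendsto_stepScale hα₀)
    rwa [ENNReal.ofReal_zero] at this
  · refine (Measure.restrict_apply_le _ _).trans ?_
    simp

/-- The Pareto density is `α s^α u^(-α-1)` on `[s,∞)`, and `s` is chosen with `s^α = h/Γ(1-α)`. -/
lemma integral_paretoStep (hα₀ : 0 < α) (hα₁ : α < 1) {h : ℝ} (hh : 0 < h) (F : ℝ → E) :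
    ∫ u, F u ∂(paretoStep α h) = h • ∫ u in Set.Ioi (stepScale α h), caputoDensity α u • F u := by
  have hG : 0 < Real.Gamma (1 - α) := Real.Gamma_pos_of_pos (by linarith)
  have hm : Measurable (paretoPDF (stepScale α h) α) :=
    (measurable_paretoPDFReal _ _).ennreal_ofReal
  have hs : stepScale α h ^ α = h / Real.Gamma (1 - α) := by
    rw [stepScale, ← Real.rpow_mul (by positivity), one_div_mul_cancel hα₀.ne', Real.rpow_one]
  rw [paretoStep, paretoMeasure, integral_withDensity_eq_integral_toReal_smul hm
    (ae_of_all _ fun _ => ENNReal.ofReal_lt_top), ← integral_Ici_eq_integral_Ioi,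
    ← integral_smul, ← integral_indicator measurableSet_Ici]
  refine integral_congr_ae (ae_of_all _ fun u => ?_)
  simp only
  by_cases hu : stepScale α h ≤ u
  · rw [Set.indicator_of_mem (by exact hu), paretoPDF, ENNReal.toReal_ofReal
      (paretoPDFReal_nonneg (stepScale_pos hα₁ hh).le hα₀.le _), paretoPDFReal, if_pos hu,
      smul_smul, hs, caputoDensity]
    congr 1
    rw [neg_add']
    ring
  · rw [Set.indicator_of_notMem (by exact hu), paretoPDF_of_lt (not_le.1 hu)]
    simp

lemma norm_caputoDensity_smul_le (hα₀ : 0 < α) (hα₁ : α < 1) {F : ℝ → E} {K : ℝ}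
    (hK : ∀ u, 0 < u → ‖F u‖ ≤ K * min 1 u) {u : ℝ} (hu : 0 < u) :
    ‖caputoDensity α u • F u‖ ≤ K * (min 1 u * caputoDensity α u) := by
  have h0 := caputoDensity_pos hα₀ hα₁ hu
  rw [norm_smul, Real.norm_eq_abs, abs_of_pos h0]
  nlinarith [hK u hu]

lemma norm_integral_caputoDensity_smul_le (hα₀ : 0 < α) (hα₁ : α < 1) {F : ℝ → E} {K : ℝ}
    (hK : ∀ u, 0 < u → ‖F u‖ ≤ K * min 1 u) {s : Set ℝ} (hs : MeasurableSet s)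
    (hs0 : s ⊆ Set.Ioi 0) :
    ‖∫ u in s, caputoDensity α u • F u‖ ≤ K * ∫ u in s, min 1 u * caputoDensity α u := by
  rw [← integral_const_mul]
  refine norm_integral_le_of_norm_le
    (((integrableOn_min_mul_caputoDensity hα₀ hα₁).mono_set hs0).const_mul K) ?_
  exact (ae_restrict_iff' hs).2 (ae_of_all _ fun u hu =>
    norm_caputoDensity_smul_le hα₀ hα₁ hK (hs0 hu))

/-- Only the jumps in `(0, stepScale α h]` are missing, hence an error `o(h)` depending on `F`
through `K` alone. It serves both for characters (`E = ℂ`) and for increments of test functions (`E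
= ℝ`). -/
lemma norm_integral_paretoStep_sub_le (hα₀ : 0 < α) (hα₁ : α < 1) {h : ℝ} (hh : 0 < h)
    {F : ℝ → E} {K : ℝ} (hF : Continuous F) (hK : ∀ u, 0 < u → ‖F u‖ ≤ K * min 1 u) :
    ‖∫ u, F u ∂(paretoStep α h) - h • ∫ u in Set.Ioi (0 : ℝ), caputoDensity α u • F u‖
      ≤ h * (K * stepError α h) := by
  have hs := stepScale_pos hα₁ hh
  have hint := integrableOn_caputoDensity_smul hα₀ hα₁ hF hK
  rw [integral_paretoStep hα₀ hα₁ hh, ← smul_sub, norm_smul, Real.norm_eq_abs, abs_of_pos hh]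
  gcongr
  rw [← Set.Ioc_union_Ioi_eq_Ioi hs.le, setIntegral_union Set.Ioc_disjoint_Ioi_same
    measurableSet_Ioi (hint.mono_set Set.Ioc_subset_Ioi_self)
    (hint.mono_set (Set.Ioi_subset_Ioi hs.le)), sub_add_cancel_right, norm_neg]
  exact norm_integral_caputoDensity_smul_le hα₀ hα₁ hK measurableSet_Ioc Set.Ioc_subset_Ioi_self

lemma norm_integral_paretoStep_le (hα₀ : 0 < α) (hα₁ : α < 1) {h : ℝ} (hh : 0 < h)
    {F : ℝ → E} {K : ℝ} (hK : ∀ u, 0 < u → ‖F u‖ ≤ K * min 1 u) (hK0 : 0 ≤ K) :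
    ‖∫ u, F u ∂(paretoStep α h)‖ ≤ h * (K * caputoMass α) := by
  have hs := stepScale_pos hα₁ hh
  have hsub : Set.Ioi (stepScale α h) ⊆ Set.Ioi 0 := Set.Ioi_subset_Ioi hs.le
  rw [integral_paretoStep hα₀ hα₁ hh, norm_smul, Real.norm_eq_abs, abs_of_pos hh]
  gcongr
  refine (norm_integral_caputoDensity_smul_le hα₀ hα₁ hK measurableSet_Ioi hsub).trans ?_
  gcongr
  refine setIntegral_mono_set (integrableOn_min_mul_caputoDensity hα₀ hα₁) ?_ hsub.eventuallyLE
  exact (ae_restrict_iff' measurableSet_Ioi).2 (ae_of_all _ fun u (hu : 0 < u) =>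
    mul_nonneg (le_min zero_le_one hu.le) (caputoDensity_pos hα₀ hα₁ hu).le)

lemma norm_exp_mul_I_sub_one_le {k R : ℝ} (hR : |k| ≤ R) {u : ℝ} (hu : 0 < u) :
    ‖Complex.exp (k * u * Complex.I) - 1‖ ≤ max 2 R * min 1 u := by
  have h := norm_exp_neg_mul_sub_one_le (z := -(k * Complex.I)) (by simp) (R := R)
    (by simpa using hR) hu
  convert h using 4
  ring

lemma charFun_sub_one {μ : Measure ℝ} [IsProbabilityMeasure μ] (k : ℝ) :
    charFun μ k - 1 = ∫ u, (Complex.exp (k * u * Complex.I) - 1) ∂μ := by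
  rw [integral_sub ?_ (integrable_const _), charFun_apply_real]
  · simp
  · refine Integrable.of_bound (C := 1) (Continuous.aestronglyMeasurable (by fun_prop))
      (ae_of_all _ fun u => le_of_eq ?_)
    rw [← Complex.ofReal_mul, Complex.norm_exp_ofReal_mul_I]

lemma norm_one_sub_charFun_paretoStep_le (hα₀ : 0 < α) (hα₁ : α < 1) {h : ℝ} (hh : 0 < h)
    {k R : ℝ} (hR : |k| ≤ R) :
    ‖1 - charFun (paretoStep α h) k‖ ≤ h * (max 2 R * caputoMass α) := by
  have := isProbabilityMeasure_paretoStep hα₀ hα₁ hh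
  rw [norm_sub_rev, charFun_sub_one]
  exact norm_integral_paretoStep_le hα₀ hα₁ hh (fun u hu => norm_exp_mul_I_sub_one_le hR hu)
    (by positivity)

/-- This is `(1 + z_n/n)^n → e^z` with `z_n → τψ(k)` by the one-step estimate. -/
lemma tendsto_charFun_paretoStep_pow (hα₀ : 0 < α) (hα₁ : α < 1) {τ : ℝ} (hτ : 0 < τ) (k : ℝ) :
    Tendsto (fun n : ℕ => charFun (paretoStep α (τ / n)) k ^ n) atTop
      (𝓝 (Complex.exp (τ * rieszFellerSymbol α (-α) k))) := by
  have h1 : Tendsto (fun n : ℕ => (n : ℂ) * (charFun (paretoStep α (τ / n)) k - 1)) atTop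
      (𝓝 (τ * rieszFellerSymbol α (-α) k)) := by
    have hz : Tendsto (fun n : ℕ => τ / (n : ℝ)) atTop (𝓝 0) := tendsto_const_div_atTop_nhds_zero_nat τ
    have herr : Tendsto (fun n : ℕ => τ * (max 2 |k| * stepError α (τ / n))) atTop (𝓝 0) := by
      have := (((tendsto_stepError hα₀ hα₁).comp hz).const_mul (max 2 |k|)).const_mul τ
      simpa using this
    refine tendsto_iff_norm_sub_tendsto_zero.2 (squeeze_zero' (Eventually.of_forall fun _ =>
      norm_nonneg _) ?_ herr)
    filter_upwards [eventually_gt_atTop 0] with n hn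
    have hn' : (0 : ℝ) < n := by exact_mod_cast hn
    have hh : 0 < τ / n := by positivity
    have := isProbabilityMeasure_paretoStep hα₀ hα₁ hh
    have h2 := norm_integral_paretoStep_sub_le hα₀ hα₁ hh
      (F := fun u : ℝ => Complex.exp (k * u * Complex.I) - 1) (by fun_prop)
      (fun u hu => norm_exp_mul_I_sub_one_le le_rfl hu)
    rw [integral_caputoDensity_smul_exp_sub_one hα₀ hα₁, ← charFun_sub_one] at h2
    have e : (n : ℂ) * (charFun (paretoStep α (τ / n)) k - 1) - τ * rieszFellerSymbol α (-α) k
        = n * (charFun (paretoStep α (τ / n)) k - 1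
          - (τ / n) • rieszFellerSymbol α (-α) k) := by
      have : (n : ℂ) ≠ 0 := by exact_mod_cast hn.ne'
      rw [Complex.real_smul]
      push_cast
      field_simp
    rw [e, norm_mul, Complex.norm_natCast]
    calc (n : ℝ) * _ ≤ n * (τ / n * (max 2 |k| * stepError α (τ / n))) := by gcongr
      _ = _ := by field_simp
  refine (Complex.tendsto_one_add_pow_exp_of_tendsto h1).congr fun n => ?_
  rw [add_sub_cancel]

end Step

/-! ### Fourier inversion of limits of characteristic functions -/

/-- The inverse Fourier transform, in the normalisation of characteristic functions. -/
noncomputable def invCharFun (φ : ℝ → ℂ) (x : ℝ) : ℂ :=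
  1 / (2 * (Real.pi : ℂ)) * ∫ k : ℝ, Complex.exp (-(Complex.I * k * x)) * φ k

/-- The characteristic function of the centred Gaussian law of variance `v`. -/
noncomputable def gaussFactor (v k : ℝ) : ℂ := Complex.exp (-(v / 2 : ℝ) * k ^ 2)

lemma norm_exp_neg_I_mul (k x : ℝ) : ‖Complex.exp (-(Complex.I * k * x))‖ = 1 := by
  have : -(Complex.I * k * x) = ((-(k * x) : ℝ) : ℂ) * Complex.I := by push_cast; ring
  rw [this, Complex.norm_exp_ofReal_mul_I]

lemma norm_gaussFactor (v k : ℝ) : ‖gaussFactor v k‖ = Real.exp (-(v / 2) * k ^ 2) := by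
  rw [gaussFactor, Complex.norm_exp]
  norm_cast

lemma norm_gaussFactor_le_one {v : ℝ} (hv : 0 ≤ v) (k : ℝ) : ‖gaussFactor v k‖ ≤ 1 := by
  rw [norm_gaussFactor, Real.exp_le_one_iff]
  nlinarith [mul_nonneg hv (sq_nonneg k)]

lemma integrable_gaussFactor {v : ℝ} (hv : 0 < v) : Integrable (gaussFactor v) := by
  refine (integrable_exp_neg_mul_sq (half_pos hv)).mono'
    (Continuous.aestronglyMeasurable (by unfold gaussFactor; fun_prop)) (ae_of_all _ fun k => ?_)
  rw [norm_gaussFactor]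

lemma gaussianPDFReal_eq_invCharFun {v : ℝ≥0} (hv : v ≠ 0) (x : ℝ) :
    (gaussianPDFReal 0 v x : ℂ) = invCharFun (gaussFactor v) x := by
  have hv' : (0 : ℝ) < v := by exact_mod_cast pos_iff_ne_zero.2 hv
  have h := fourierIntegral_gaussian (b := ((v / 2 : ℝ) : ℂ)) (by simpa using hv') (-x : ℂ)
  have e : ∫ k : ℝ, Complex.exp (-(Complex.I * k * x)) * gaussFactor v k
      = ∫ k : ℝ, Complex.exp (Complex.I * (-x) * k) * Complex.exp (-((v / 2 : ℝ) : ℂ) * k ^ 2) := by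
    refine integral_congr_ae (ae_of_all _ fun k => ?_)
    simp only [gaussFactor]
    congr 2
    ring
  rw [invCharFun, e, h, gaussianPDFReal]
  have h1 : ((Real.pi : ℂ) / ((v / 2 : ℝ) : ℂ)) ^ (1 / 2 : ℂ) = ((√(Real.pi / (v / 2)) : ℝ) : ℂ) := by
    rw [Real.sqrt_eq_rpow, Complex.ofReal_cpow (by positivity)]
    push_cast
    rfl
  have h2 : Complex.exp (-(-(x : ℂ)) ^ 2 / (4 * ((v / 2 : ℝ) : ℂ)))
      = ((Real.exp (-(x - 0) ^ 2 / (2 * v)) : ℝ) : ℂ) := by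
    rw [Complex.ofReal_exp]
    congr 1
    push_cast
    ring
  rw [h1, h2]
  have h3 : (√(2 * Real.pi * v))⁻¹ = 1 / (2 * Real.pi) * √(Real.pi / (v / 2)) := ?_
  · rw [h3]
    push_cast
    ring
  rw [show Real.pi / ((v : ℝ) / 2) = (2 * Real.pi) ^ 2 / (2 * Real.pi * v) by field_simp,
    Real.sqrt_div (by positivity), Real.sqrt_sq (by positivity)]
  field_simp

/-- Fubini; the Gaussian factor supplies absolute integrability in `k`, whatever `μ` is. -/
lemma convOp_gaussianPDFReal_eq_invCharFun (μ : Measure ℝ) [IsProbabilityMeasure μ] {v : ℝ≥0}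
    (hv : v ≠ 0) (x : ℝ) :
    (convOp μ (gaussianPDFReal 0 v) x : ℂ) = invCharFun (fun k => charFun μ k * gaussFactor v k) x := by
  have hv' : (0 : ℝ) < v := by exact_mod_cast pos_iff_ne_zero.2 hv
  unfold convOp
  rw [← integral_complex_ofReal]
  simp_rw [gaussianPDFReal_eq_invCharFun hv, invCharFun]
  rw [integral_const_mul, integral_integral_swap]
  · congr 1
    refine integral_congr_ae (ae_of_all _ fun k => ?_)
    simp only
    rw [charFun_apply_real, ← integral_mul_const, ← integral_const_mul]
    refine integral_congr_ae (ae_of_all _ fun y => ?_)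
    simp only
    rw [← mul_assoc, ← Complex.exp_add]
    congr 2
    push_cast
    ring
  · have h := (integrable_gaussFactor hv').comp_snd μ
    refine Integrable.mono' h.norm (Continuous.aestronglyMeasurable ?_) (ae_of_all _ fun p => ?_)
    · unfold gaussFactor
      fun_prop
    · simp only [Function.uncurry]
      rw [norm_mul, norm_exp_neg_I_mul, one_mul]

lemma lintegral_convOp_gaussianPDFReal (μ : Measure ℝ) [IsProbabilityMeasure μ] {v : ℝ≥0}
    (hv : v ≠ 0) : ∫⁻ x, ENNReal.ofReal (convOp μ (gaussianPDFReal 0 v) x) = 1 := by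
  have h : (μ.conv (gaussianReal 0 v)) Set.univ = 1 := measure_univ
  rwa [conv_gaussianReal μ hv, withDensity_apply _ MeasurableSet.univ,
    Measure.restrict_univ] at h

lemma continuous_invCharFun {φ : ℝ → ℂ} (hφ : Integrable φ) : Continuous (invCharFun φ) := by
  unfold invCharFun
  refine continuous_const.mul (continuous_of_dominated (bound := fun k => ‖φ k‖) (fun x =>
    (Continuous.aestronglyMeasurable (by fun_prop)).mul hφ.aestronglyMeasurable)
    (fun x => ae_of_all _ fun k => ?_) hφ.norm (ae_of_all _ fun k => by fun_prop))
  rw [norm_mul, norm_exp_neg_I_mul, one_mul]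

lemma tendsto_invCharFun {φ : ℕ → ℝ → ℂ} {ψ : ℝ → ℂ} {b : ℝ → ℝ} (hb : Integrable b)
    (hφ : ∀ n, AEStronglyMeasurable (φ n) volume) (hφb : ∀ n k, ‖φ n k‖ ≤ b k)
    (h : ∀ k, Tendsto (fun n => φ n k) atTop (𝓝 (ψ k))) (x : ℝ) :
    Tendsto (fun n => invCharFun (φ n) x) atTop (𝓝 (invCharFun ψ x)) := by
  unfold invCharFun
  refine Tendsto.const_mul _ (tendsto_integral_of_dominated_convergence b (fun n =>
    (Continuous.aestronglyMeasurable (by fun_prop)).mul (hφ n)) hb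
    (fun n => ae_of_all _ fun k => ?_) (ae_of_all _ fun k => (h k).const_mul _))
  rw [norm_mul, norm_exp_neg_I_mul, one_mul]
  exact hφb n k

/-- `g` takes real nonnegative values and has total integral at most `1`. -/
def IsSubdensity (g : ℝ → ℂ) : Prop :=
  (∀ x, 0 ≤ (g x).re ∧ (g x).im = 0) ∧ ∫⁻ x, ENNReal.ofReal (g x).re ≤ 1

/-- Fatou's lemma, which is why only the bound `≤ 1` on the mass is kept. -/
lemma IsSubdensity.of_tendsto {g : ℕ → ℝ → ℂ} {f : ℝ → ℂ} (hg : ∀ n, IsSubdensity (g n))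
    (hm : ∀ n, Continuous (g n))
    (h : ∀ x, Tendsto (fun n => g n x) atTop (𝓝 (f x))) : IsSubdensity f := by
  have hre : ∀ x, Tendsto (fun n => (g n x).re) atTop (𝓝 (f x).re) := fun x =>
    (Complex.continuous_re.tendsto _).comp (h x)
  have him : ∀ x, Tendsto (fun n => (g n x).im) atTop (𝓝 (f x).im) := fun x =>
    (Complex.continuous_im.tendsto _).comp (h x)
  refine ⟨fun x => ⟨ge_of_tendsto' (hre x) fun n => ((hg n).1 x).1,
    tendsto_nhds_unique (him x) (by simp [fun n => ((hg n).1 x).2])⟩, ?_⟩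
  calc ∫⁻ x, ENNReal.ofReal (f x).re
      = ∫⁻ x, liminf (fun n => ENNReal.ofReal (g n x).re) atTop :=
        lintegral_congr fun x => ((ENNReal.tendsto_ofReal (hre x)).liminf_eq).symm
    _ ≤ liminf (fun n => ∫⁻ x, ENNReal.ofReal (g n x).re) atTop :=
        lintegral_liminf_le fun n => by
          have := hm n
          fun_prop
    _ ≤ 1 := by
        refine liminf_le_of_le (by isBoundedDefault) fun b hb => ?_
        obtain ⟨n, hn⟩ := hb.exists
        exact hn.trans (hg n).2

lemma isSubdensity_invCharFun_charFun_mul_gaussFactor (μ : Measure ℝ) [IsProbabilityMeasure μ]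
    {v : ℝ≥0} (hv : v ≠ 0) :
    IsSubdensity (invCharFun fun k => charFun μ k * gaussFactor v k) := by
  refine ⟨fun x => ?_, ?_⟩
  · rw [← convOp_gaussianPDFReal_eq_invCharFun μ hv, Complex.ofReal_re, Complex.ofReal_im]
    exact ⟨integral_nonneg fun y => gaussianPDFReal_nonneg 0 v _, rfl⟩
  · simp_rw [← convOp_gaussianPDFReal_eq_invCharFun μ hv, Complex.ofReal_re]
    exact (lintegral_convOp_gaussianPDFReal μ hv).le

/-- Two successive limits: first `n → ∞` at fixed smoothing `v`, dominated by the Gaussian factor,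
then `v → 0`, dominated by `‖φ‖`. The smoothing is needed because the `charFun (μ n)` need not be
integrable. -/
lemma isSubdensity_invCharFun_of_tendsto {μ : ℕ → Measure ℝ}
    [hμ : ∀ n, IsProbabilityMeasure (μ n)] {φ : ℝ → ℂ} (hφ : Integrable φ) (hc : Continuous φ)
    (h : ∀ k, Tendsto (fun n => charFun (μ n) k) atTop (𝓝 (φ k))) :
    IsSubdensity (invCharFun φ) := by
  have hφ1 : ∀ k, ‖φ k‖ ≤ 1 := fun k => le_of_tendsto' (h k).norm fun n => norm_charFun_le_one k
  have hgc : ∀ v, Continuous (gaussFactor v) := fun v => by unfold gaussFactor; fun_prop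
  have h1 : ∀ v : ℝ≥0, v ≠ 0 → IsSubdensity (invCharFun fun k => φ k * gaussFactor v k) := by
    intro v hv
    have hv' : (0 : ℝ) < v := by exact_mod_cast pos_iff_ne_zero.2 hv
    have hm : ∀ n, AEStronglyMeasurable (fun k => charFun (μ n) k * gaussFactor v k) volume :=
      fun n => stronglyMeasurable_charFun.aestronglyMeasurable.mul (hgc v).aestronglyMeasurable
    have hb : ∀ n k, ‖charFun (μ n) k * gaussFactor v k‖ ≤ ‖gaussFactor v k‖ := fun n k => by
      rw [norm_mul]
      exact mul_le_of_le_one_left (norm_nonneg _) (norm_charFun_le_one k)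
    refine IsSubdensity.of_tendsto
      (fun n => isSubdensity_invCharFun_charFun_mul_gaussFactor (μ n) hv) (fun n => ?_)
      (tendsto_invCharFun (integrable_gaussFactor hv').norm hm hb fun k => (h k).mul_const _)
    exact continuous_invCharFun ((integrable_gaussFactor hv').norm.mono' (hm n)
      (ae_of_all _ (hb n)))
  have hb : ∀ (n : ℕ) k, ‖φ k * gaussFactor ((1 / ((n : ℝ≥0) + 1) : ℝ≥0) : ℝ) k‖ ≤ ‖φ k‖ :=
    fun n k => by
      rw [norm_mul]
      exact mul_le_of_le_one_right (norm_nonneg _) (norm_gaussFactor_le_one (by positivity) k)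
  have hm : ∀ n : ℕ, AEStronglyMeasurable
      (fun k => φ k * gaussFactor ((1 / ((n : ℝ≥0) + 1) : ℝ≥0) : ℝ) k) volume :=
    fun n => (hc.mul (hgc _)).aestronglyMeasurable
  refine IsSubdensity.of_tendsto (fun n : ℕ => h1 (1 / ((n : ℝ≥0) + 1)) (by positivity))
    (fun n => continuous_invCharFun (hφ.norm.mono' (hm n) (ae_of_all _ (hb n))))
    (tendsto_invCharFun hφ.norm hm hb fun k => ?_)
  have hz := tendsto_one_div_add_atTop_nhds_zero_nat (𝕜 := ℝ)
  have hg : Continuous fun v : ℝ => φ k * gaussFactor v k := by unfold gaussFactor; fun_prop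
  refine (hg.tendsto' 0 (φ k) ?_).comp (hz.congr fun n => ?_)
  · simp [gaussFactor]
  · push_cast
    rfl

/-- Fourier inversion, rescaled by `2π` to the normalisation of characteristic functions. -/
lemma integral_exp_mul_invCharFun {φ : ℝ → ℂ} (hφ : Integrable φ) (hc : Continuous φ)
    (hG : Integrable (invCharFun φ)) (k : ℝ) :
    ∫ x : ℝ, Complex.exp (k * x * Complex.I) * invCharFun φ x = φ k := by
  have hpi : (0 : ℝ) < 2 * Real.pi := by positivity
  have hF : FourierTransform.fourier φ
      = fun w : ℝ => (2 * Real.pi : ℂ) * invCharFun φ (2 * Real.pi * w) := by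
    ext w
    rw [Real.fourier_real_eq_integral_exp_smul, invCharFun, ← mul_assoc, mul_one_div_cancel
      (by exact_mod_cast hpi.ne'), one_mul]
    refine integral_congr_ae (ae_of_all _ fun x => ?_)
    simp only [smul_eq_mul]
    congr 2
    push_cast
    ring
  have hFi : Integrable (FourierTransform.fourier φ) := by
    rw [hF]
    exact (hG.comp_mul_left' hpi.ne').const_mul _
  have h := congrFun (hc.fourierInv_fourier_eq hφ hFi) k
  rw [Real.fourierInv_eq', hF] at h
  rw [← h]
  have e := Measure.integral_comp_mul_left
    (fun x : ℝ => Complex.exp (k * x * Complex.I) * invCharFun φ x) (2 * Real.pi)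
  rw [abs_of_pos (inv_pos.2 hpi), eq_inv_smul_iff₀ hpi.ne', ← integral_smul] at e
  rw [← e]
  refine integral_congr_ae (ae_of_all _ fun x => ?_)
  simp only [smul_eq_mul, Complex.real_smul, RCLike.inner_apply, conj_trivial]
  rw [mul_left_comm]
  push_cast
  congr 3
  ring

/-- A continuous integrable limit of characteristic functions is the characteristic function of the
law whose density is its inverse Fourier transform. -/
theorem invCharFun_of_tendsto {μ : ℕ → Measure ℝ} [hμ : ∀ n, IsProbabilityMeasure (μ n)]
    {φ : ℝ → ℂ} (hφ : Integrable φ) (hc : Continuous φ) (h0 : φ 0 = 1)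
    (h : ∀ k, Tendsto (fun n => charFun (μ n) k) atTop (𝓝 (φ k))) :
    (∀ x, 0 ≤ (invCharFun φ x).re) ∧ Integrable (fun x => (invCharFun φ x).re) ∧
      ∫ x, (invCharFun φ x).re = 1 ∧
      ∀ k, charFun (volume.withDensity fun x => ENNReal.ofReal (invCharFun φ x).re) k = φ k := by
  have hs := isSubdensity_invCharFun_of_tendsto hφ hc h
  have hcont := continuous_invCharFun hφ
  have hre : Continuous fun x => (invCharFun φ x).re := Complex.continuous_re.comp hcont
  have hofReal : ∀ x, invCharFun φ x = ((invCharFun φ x).re : ℂ) := fun x =>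
    Complex.ext rfl (hs.1 x).2
  have hint : Integrable fun x => (invCharFun φ x).re := by
    refine ⟨hre.aestronglyMeasurable, ?_⟩
    rw [hasFiniteIntegral_iff_ofReal (ae_of_all _ fun x => (hs.1 x).1)]
    exact hs.2.trans_lt ENNReal.one_lt_top
  have hG : Integrable (invCharFun φ) := by
    refine hint.ofReal.congr (ae_of_all _ fun x => (hofReal x).symm)
  have hinv := integral_exp_mul_invCharFun hφ hc hG
  refine ⟨fun x => (hs.1 x).1, hint, ?_, fun k => ?_⟩
  -- The exact mass, possibly lost in Fatou's lemma, is recovered from `φ 0 = 1`.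
  · have := hinv 0
    rw [h0] at this
    have e : ∫ x, invCharFun φ x = ((∫ x, (invCharFun φ x).re : ℝ) : ℂ) := by
      rw [← integral_complex_ofReal]
      exact integral_congr_ae (ae_of_all _ hofReal)
    have h1 : ((∫ x, (invCharFun φ x).re : ℝ) : ℂ) = 1 := by
      rw [← e, ← this]
      simp
    exact_mod_cast h1
  · rw [charFun_apply_real, integral_withDensity_eq_integral_toReal_smul hre.measurable.ennreal_ofReal
      (ae_of_all _ fun _ => ENNReal.ofReal_lt_top), ← hinv k]
    refine integral_congr_ae (ae_of_all _ fun x => ?_)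
    simp only
    rw [ENNReal.toReal_ofReal (hs.1 x).1, Complex.real_smul, ← hofReal, mul_comm]

/-! ### The one-sided stable laws -/

lemma integrable_comp_abs {f : ℝ → ℝ} (hf : IntegrableOn f (Set.Ioi 0)) :
    Integrable fun x => f |x| := by
  have h1 : IntegrableOn (fun x => f |x|) (Set.Ioi 0) :=
    hf.congr_fun (fun x (hx : 0 < x) => by rw [abs_of_pos hx]) measurableSet_Ioi
  have h2 : IntegrableOn (fun x => f |x|) (Set.Iic 0) := by
    have h3 : IntegrableOn (fun x => f |x|) (Set.Ici (-0)) := by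
      rwa [neg_zero, integrableOn_Ici_iff_integrableOn_Ioi]
    simpa using h3.comp_neg_Iic
  rw [← integrableOn_univ, ← Set.Iic_union_Ioi (a := (0 : ℝ))]
  exact h2.union h1

section Symbol

variable {α : ℝ}

@[simp]
lemma rieszFellerSymbol_zero (hα₀ : 0 < α) : rieszFellerSymbol α (-α) 0 = 0 := by
  simp [rieszFellerSymbol, hα₀.ne']

lemma re_rieszFellerSymbol (hα₀ : 0 < α) (k : ℝ) :
    (rieszFellerSymbol α (-α) k).re = -(|k| ^ α * Real.cos (α * Real.pi / 2)) := by
  rcases eq_or_ne k 0 with rfl | hk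
  · simp [rieszFellerSymbol, hα₀.ne']
  rw [rieszFellerSymbol, neg_mul, Complex.neg_re, Complex.re_ofReal_mul, mul_comm Complex.I,
    Complex.exp_ofReal_mul_I_re]
  rcases hk.lt_or_gt with hk | hk
  · have hs : ((-1 : SignType) : ℝ) = -1 := by simp
    rw [sign_neg hk, hs]
    congr 3
    ring
  · have hs : ((1 : SignType) : ℝ) = 1 := by simp
    rw [sign_pos hk, hs, ← Real.cos_neg]
    congr 3
    ring

lemma cos_mul_pi_div_two_pos (hα₀ : 0 < α) (hα₁ : α < 1) : 0 < Real.cos (α * Real.pi / 2) :=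
  Real.cos_pos_of_mem_Ioo ⟨by nlinarith [Real.pi_pos], by nlinarith [Real.pi_pos]⟩

lemma re_rieszFellerSymbol_nonpos (hα₀ : 0 < α) (hα₁ : α < 1) (k : ℝ) :
    (rieszFellerSymbol α (-α) k).re ≤ 0 := by
  rw [re_rieszFellerSymbol hα₀]
  have := cos_mul_pi_div_two_pos hα₀ hα₁
  have : 0 ≤ |k| ^ α := by positivity
  nlinarith

lemma continuous_rieszFellerSymbol (hα₀ : 0 < α) (hα₁ : α < 1) :
    Continuous (rieszFellerSymbol α (-α)) := by
  have h : rieszFellerSymbol α (-α) = fun k : ℝ => laplaceExponent α (-(k * Complex.I)) :=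
    funext fun k => (laplaceExponent_neg_mul_I hα₀ hα₁ k).symm
  rw [h]
  exact (continuousOn_laplaceExponent hα₀ hα₁).comp_continuous (by fun_prop) fun k => by simp

lemma rieszFellerSymbol_mul {a : ℝ} (ha : 0 < a) (θ k : ℝ) :
    rieszFellerSymbol α θ (a * k) = (a ^ α : ℝ) * rieszFellerSymbol α θ k := by
  have hs : SignType.sign (a * k) = SignType.sign k := by
    rw [sign_mul, sign_pos ha, one_mul]
  rw [rieszFellerSymbol, rieszFellerSymbol, hs, abs_mul, abs_of_pos ha,
    Real.mul_rpow ha.le (abs_nonneg k)]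
  push_cast
  ring

/-- The modulus is `exp(-τ cos(απ/2) |k|^α)`, and the cosine is positive because `α < 1`. -/
lemma integrable_exp_mul_rieszFellerSymbol (hα₀ : 0 < α) (hα₁ : α < 1) {τ : ℝ} (hτ : 0 < τ) :
    Integrable fun k => Complex.exp (τ * rieszFellerSymbol α (-α) k) := by
  have hc := cos_mul_pi_div_two_pos hα₀ hα₁
  have h := integrable_comp_abs (integrableOn_rpow_mul_exp_neg_mul_rpow (s := 0) (p := α)
    (b := τ * Real.cos (α * Real.pi / 2)) (by norm_num) hα₀ (by positivity))
  have hψ := continuous_rieszFellerSymbol hα₀ hα₁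
  refine h.mono' (Continuous.aestronglyMeasurable (by fun_prop)) (ae_of_all _ fun k => le_of_eq ?_)
  rw [Complex.norm_exp, Complex.re_ofReal_mul, re_rieszFellerSymbol hα₀, Real.rpow_zero,
    one_mul]
  congr 1
  ring

end Symbol

section Stable

variable {α : ℝ}

/-- The shift to `n + 1` keeps every step size positive, as the Pareto law requires. -/
lemma isProbabilityMeasure_convPow_paretoStep (hα₀ : 0 < α) (hα₁ : α < 1) {τ : ℝ} (hτ : 0 < τ)
    (n : ℕ) : IsProbabilityMeasure (convPow (paretoStep α (τ / (n + 1 : ℕ))) (n + 1)) := by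
  have := isProbabilityMeasure_paretoStep hα₀ hα₁ (h := τ / (n + 1 : ℕ)) (by positivity)
  infer_instance

lemma tendsto_charFun_convPow_paretoStep (hα₀ : 0 < α) (hα₁ : α < 1) {τ : ℝ} (hτ : 0 < τ) (k : ℝ) :
    Tendsto (fun n : ℕ => charFun (convPow (paretoStep α (τ / (n + 1 : ℕ))) (n + 1)) k) atTop
      (𝓝 (Complex.exp (τ * rieszFellerSymbol α (-α) k))) := by
  refine ((tendsto_charFun_paretoStep_pow hα₀ hα₁ hτ k).comp (tendsto_add_atTop_nat 1)).congr
    fun n => ?_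
  have := isProbabilityMeasure_paretoStep hα₀ hα₁ (h := τ / (n + 1 : ℕ)) (by positivity)
  rw [charFun_convPow]
  rfl

lemma rieszFellerKernel_properties (hα₀ : 0 < α) (hα₁ : α < 1) {τ : ℝ} (hτ : 0 < τ) :
    (∀ x, 0 ≤ rieszFellerKernel α (-α) x τ) ∧ Integrable (fun x => rieszFellerKernel α (-α) x τ) ∧
      ∫ x, rieszFellerKernel α (-α) x τ = 1 ∧
      ∀ k, charFun (volume.withDensity fun x => ENNReal.ofReal (rieszFellerKernel α (-α) x τ)) k
        = Complex.exp (τ * rieszFellerSymbol α (-α) k) := by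
  have hψ := continuous_rieszFellerSymbol hα₀ hα₁
  exact invCharFun_of_tendsto (hμ := isProbabilityMeasure_convPow_paretoStep hα₀ hα₁ hτ)
    (integrable_exp_mul_rieszFellerSymbol hα₀ hα₁ hτ) (by fun_prop) (by simp [hα₀])
    (tendsto_charFun_convPow_paretoStep hα₀ hα₁ hτ)

lemma continuous_rieszFellerKernel (hα₀ : 0 < α) (hα₁ : α < 1) {τ : ℝ} (hτ : 0 < τ) :
    Continuous fun x => rieszFellerKernel α (-α) x τ :=
  Complex.continuous_re.comp
    (continuous_invCharFun (integrable_exp_mul_rieszFellerSymbol hα₀ hα₁ hτ))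

lemma isProbabilityMeasure_rieszFellerLaw (hα₀ : 0 < α) (hα₁ : α < 1) {τ : ℝ} (hτ : 0 ≤ τ) :
    IsProbabilityMeasure (rieszFellerLaw α (-α) τ) := by
  rcases hτ.eq_or_lt with rfl | hτ
  · rw [rieszFellerLaw, if_pos rfl]
    infer_instance
  · obtain ⟨h0, hi, h1, -⟩ := rieszFellerKernel_properties hα₀ hα₁ hτ
    rw [rieszFellerLaw, if_neg hτ.ne']
    refine ⟨?_⟩
    rw [withDensity_apply _ MeasurableSet.univ, Measure.restrict_univ,
      ← ofReal_integral_eq_lintegral_ofReal hi (ae_of_all _ h0), h1, ENNReal.ofReal_one]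

lemma charFun_rieszFellerLaw (hα₀ : 0 < α) (hα₁ : α < 1) {τ : ℝ} (hτ : 0 ≤ τ) (k : ℝ) :
    charFun (rieszFellerLaw α (-α) τ) k = Complex.exp (τ * rieszFellerSymbol α (-α) k) := by
  rcases hτ.eq_or_lt with rfl | hτ
  · rw [rieszFellerLaw, if_pos rfl]
    simp
  · rw [rieszFellerLaw, if_neg hτ.ne']
    exact (rieszFellerKernel_properties hα₀ hα₁ hτ).2.2.2 k

/-- On the Fourier side this is the homogeneity `ψ(ak) = a^α ψ(k)` for `a > 0`. -/
lemma isStrictlyStable_rieszFellerLaw (hα₀ : 0 < α) (hα₁ : α < 1) {τ : ℝ} (hτ : 0 ≤ τ) :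
    IsStrictlyStable α (rieszFellerLaw α (-α) τ) := by
  intro a b ha hb
  have := isProbabilityMeasure_rieszFellerLaw hα₀ hα₁ hτ
  have hab : 0 < a ^ α + b ^ α := by positivity
  have i1 : ∀ c : ℝ, IsProbabilityMeasure ((rieszFellerLaw α (-α) τ).map (fun x => c * x)) :=
    fun c => Measure.isProbabilityMeasure_map (by fun_prop)
  refine Measure.ext_of_charFun (funext fun k => ?_)
  rw [charFun_conv, charFun_map_mul, charFun_map_mul, charFun_map_mul,
    charFun_rieszFellerLaw hα₀ hα₁ hτ, charFun_rieszFellerLaw hα₀ hα₁ hτ,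
    charFun_rieszFellerLaw hα₀ hα₁ hτ, ← Complex.exp_add, rieszFellerSymbol_mul ha,
    rieszFellerSymbol_mul hb, rieszFellerSymbol_mul (by positivity), ← Real.rpow_mul hab.le,
    one_div_mul_cancel hα₀.ne', Real.rpow_one]
  congr 1
  push_cast
  ring

lemma tendsto_convPow_paretoStep (hα₀ : 0 < α) (hα₁ : α < 1) {τ : ℝ} (hτ : 0 < τ) :
    Tendsto (β := ProbabilityMeasure ℝ)
      (fun n : ℕ => ⟨convPow (paretoStep α (τ / (n + 1 : ℕ))) (n + 1),
        isProbabilityMeasure_convPow_paretoStep hα₀ hα₁ hτ n⟩) atTop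
      (𝓝 ⟨rieszFellerLaw α (-α) τ, isProbabilityMeasure_rieszFellerLaw hα₀ hα₁ hτ.le⟩) := by
  refine ProbabilityMeasure.tendsto_iff_tendsto_charFun.2 fun k => ?_
  simp only [ProbabilityMeasure.coe_mk, charFun_rieszFellerLaw hα₀ hα₁ hτ.le]
  exact tendsto_charFun_convPow_paretoStep hα₀ hα₁ hτ k

lemma conv_Iio_zero {μ ν : Measure ℝ} [SFinite μ] [SFinite ν] (hμ : μ (Set.Iio 0) = 0)
    (hν : ν (Set.Iio 0) = 0) : (μ.conv ν) (Set.Iio 0) = 0 := by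
  rw [← lintegral_indicator_one measurableSet_Iio,
    Measure.lintegral_conv (measurable_one.indicator measurableSet_Iio)]
  have h1 : ∀ᵐ x ∂μ, 0 ≤ x := by
    filter_upwards [measure_eq_zero_iff_ae_notMem.1 hμ] with x hx
    simpa using hx
  have h2 : ∀ᵐ x ∂ν, 0 ≤ x := by
    filter_upwards [measure_eq_zero_iff_ae_notMem.1 hν] with x hx
    simpa using hx
  have h3 : ∀ᵐ x ∂μ, ∫⁻ y, (Set.Iio (0 : ℝ)).indicator (1 : ℝ → ℝ≥0∞) (x + y) ∂ν = 0 := by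
    filter_upwards [h1] with x hx
    have : ∀ᵐ y ∂ν, (Set.Iio (0 : ℝ)).indicator (1 : ℝ → ℝ≥0∞) (x + y) = 0 := by
      filter_upwards [h2] with y hy
      exact Set.indicator_of_notMem (by simp; linarith) _
    rw [lintegral_congr_ae this, lintegral_zero]
  rw [lintegral_congr_ae h3, lintegral_zero]

lemma paretoStep_Iio_zero (hα₁ : α < 1) {h : ℝ} (hh : 0 < h) :
    paretoStep α h (Set.Iio 0) = 0 := by
  rw [paretoStep, paretoMeasure, withDensity_apply _ measurableSet_Iio]
  exact lintegral_paretoPDF_of_le (stepScale_pos hα₁ hh).le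

lemma convPow_Iio_zero {μ : Measure ℝ} [IsProbabilityMeasure μ] (hμ : μ (Set.Iio 0) = 0) (n : ℕ) :
    convPow μ n (Set.Iio 0) = 0 := by
  induction n with
  | zero => simp [convPow]
  | succ n ih => exact conv_Iio_zero ih hμ

/-- The approximating Pareto sums are nonnegative; the portmanteau inequality for the open set
`(-∞,0)` passes this to the limit. -/
lemma rieszFellerLaw_Iio_zero (hα₀ : 0 < α) (hα₁ : α < 1) {τ : ℝ} (hτ : 0 ≤ τ) :
    rieszFellerLaw α (-α) τ (Set.Iio 0) = 0 := by
  rcases hτ.eq_or_lt with rfl | hτ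
  · rw [rieszFellerLaw, if_pos rfl]
    simp
  have h := ProbabilityMeasure.le_liminf_measure_open_of_tendsto
    (tendsto_convPow_paretoStep hα₀ hα₁ hτ) (isOpen_Iio (a := (0 : ℝ)))
  have h0 : ∀ n : ℕ, convPow (paretoStep α (τ / (n + 1 : ℕ))) (n + 1) (Set.Iio 0) = 0 := fun n => by
    have hn : 0 < τ / (n + 1 : ℕ) := by positivity
    have := isProbabilityMeasure_paretoStep hα₀ hα₁ hn
    exact convPow_Iio_zero (paretoStep_Iio_zero hα₁ hn) _
  simp only [ProbabilityMeasure.coe_mk, h0, liminf_const] at h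
  exact le_antisymm h zero_le

lemma rieszFellerKernel_eq_zero (hα₀ : 0 < α) (hα₁ : α < 1) {τ : ℝ} (hτ : 0 < τ) {x : ℝ}
    (hx : x ≤ 0) : rieszFellerKernel α (-α) x τ = 0 := by
  have hc := continuous_rieszFellerKernel hα₀ hα₁ hτ
  have h := rieszFellerLaw_Iio_zero hα₀ hα₁ hτ.le
  rw [rieszFellerLaw, if_neg hτ.ne', withDensity_apply _ measurableSet_Iio,
    lintegral_eq_zero_iff (by fun_prop)] at h
  have h1 : (fun x => rieszFellerKernel α (-α) x τ) =ᵐ[volume.restrict (Set.Iio 0)] fun _ => 0 := by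
    filter_upwards [h] with y hy
    exact le_antisymm (ENNReal.ofReal_eq_zero.1 hy)
      ((rieszFellerKernel_properties hα₀ hα₁ hτ).1 y)
  -- Continuity turns vanishing almost everywhere into vanishing on `(-∞,0)`, then on its closure,
  -- which includes `0`.
  have h2 := Measure.eqOn_open_of_ae_eq h1 isOpen_Iio hc.continuousOn continuousOn_const
  have h3 : Set.EqOn (fun x => rieszFellerKernel α (-α) x τ) (fun _ => 0)
      (closure (Set.Iio (0 : ℝ))) := h2.closure hc continuous_const
  rw [closure_Iio] at h3
  exact h3 hx

lemma isOneSidedStableDensity_rieszFellerKernel (hα₀ : 0 < α) (hα₁ : α < 1) {τ : ℝ} (hτ : 0 < τ) :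
    IsOneSidedStableDensity α (fun x => rieszFellerKernel α (-α) x τ) := by
  obtain ⟨h0, hi, h1, -⟩ := rieszFellerKernel_properties hα₀ hα₁ hτ
  refine ⟨h0, fun x hx => rieszFellerKernel_eq_zero hα₀ hα₁ hτ hx, hi, h1, ?_⟩
  have := isStrictlyStable_rieszFellerLaw hα₀ hα₁ hτ.le
  rwa [rieszFellerLaw, if_neg hτ.ne'] at this

end Stable

/-! ### The Caputo derivative as an integral operator -/

/-- The generator `-D^α` in the form `∫_0^∞ (f(x-u) - f(x)) ν(du)`. -/
noncomputable def caputoGenerator (α : ℝ) (f : ℝ → ℝ) (x : ℝ) : ℝ :=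
  ∫ u in Set.Ioi (0 : ℝ), caputoDensity α u • (f (x - u) - f x)

section C02

variable {f : ℝ → ℝ}

lemma IsC02.hasDerivAt (hf : IsC02 f) (x : ℝ) : HasDerivAt f (deriv f x) x :=
  (hf.1.differentiable (by norm_num) x).hasDerivAt

lemma abs_sub_le_of_deriv {g g' : ℝ → ℝ} {M : ℝ} (hg : ∀ x, HasDerivAt g (g' x) x)
    (hM : ∀ x, |g' x| ≤ M) (x y : ℝ) : |g x - g y| ≤ M * |x - y| := by
  have := convex_univ.norm_image_sub_le_of_norm_hasDerivWithin_le (f := g) (f' := g') (C := M)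
    (x := y) (y := x) (fun z _ => (hg z).hasDerivWithinAt) (fun z _ => hM z) trivial trivial
  simpa using this

lemma IsC02.exists_bound_sub (hf : IsC02 f) :
    ∃ K, 0 ≤ K ∧ (∀ x u, 0 < u → ‖f (x - u) - f x‖ ≤ K * min 1 u) ∧
      ∀ x y, |f x - f y| ≤ K * |x - y| := by
  obtain ⟨B, hB0, hB⟩ := hf.2.1.exists_bound
  obtain ⟨M, hM0, hM⟩ := hf.2.2.1.exists_bound
  have hL := abs_sub_le_of_deriv hf.hasDerivAt hM
  refine ⟨max (2 * B) M, by positivity, fun x u hu => le_mul_min_one ?_ ?_ hu, fun x y => ?_⟩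
  · refine (abs_sub _ _).trans ?_
    linarith [hB (x - u), hB x]
  · have := hL (x - u) x
    rwa [show x - u - x = -u by ring, abs_neg, abs_of_pos hu] at this
  · exact (hL x y).trans (by gcongr; exact le_max_right _ _)

end C02

section Caputo

variable {α : ℝ} {f : ℝ → ℝ}

lemma intervalIntegrable_mul_rpow_neg {g : ℝ → ℝ} (hg : Continuous g) (hα₁ : α < 1) (a b : ℝ) :
    IntervalIntegrable (fun u => g u * u ^ (-α)) volume a b :=
  (intervalIntegral.intervalIntegrable_rpow' (by linarith)).continuousOn_mul hg.continuousOn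

/-- Integration by parts against `u^(-α)`. Taking `f(x-u) - f(x)`, which vanishes at `u = 0`, as the
primitive removes the boundary term there. -/
lemma integral_deriv_mul_rpow_neg (hα₀ : 0 < α) (hα₁ : α < 1) (hf : IsC02 f) (x : ℝ) {M : ℝ}
    (hM : 0 < M) :
    1 / Real.Gamma (1 - α) * ∫ u in 0..M, deriv f (x - u) * u ^ (-α)
      = -(∫ u in 0..M, caputoDensity α u • (f (x - u) - f x))
        - 1 / Real.Gamma (1 - α) * ((f (x - M) - f x) * M ^ (-α)) := by
  obtain ⟨K, hK0, hK, -⟩ := hf.exists_bound_sub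
  have hfc : Continuous f := hf.2.1.1
  have hdc : Continuous (deriv f) := hf.2.2.1.1
  have hw : IntervalIntegrable (fun u => caputoDensity α u • (f (x - u) - f x)) volume 0 M := by
    rw [intervalIntegrable_iff_integrableOn_Ioc_of_le hM.le]
    exact (integrableOn_caputoDensity_smul hα₀ hα₁ (by fun_prop) (hK x)).mono_set
      Set.Ioc_subset_Ioi_self
  have hd := intervalIntegrable_mul_rpow_neg (g := fun u => deriv f (x - u)) (by fun_prop) hα₁ 0 M
  have hcont : ContinuousOn (fun u => (f (x - u) - f x) * u ^ (-α)) (Set.Icc 0 M) := by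
    intro u hu
    rcases hu.1.eq_or_lt with rfl | hu0
    -- At `u = 0` the increment is `O(u)`, so the product with `u^(-α)` is `O(u^(1-α))`.
    · have h1 : Tendsto (fun u : ℝ => K * |u| ^ (1 - α)) (𝓝[Set.Icc 0 M] 0) (𝓝 0) := by
        have : Continuous fun u : ℝ => K * |u| ^ (1 - α) :=
          continuous_const.mul (continuous_abs.rpow_const fun u => Or.inr (by linarith))
        refine (this.tendsto' 0 0 ?_).mono_left nhdsWithin_le_nhds
        rw [abs_zero, Real.zero_rpow (by linarith), mul_zero]
      have h2 : (f (x - 0) - f x) * (0 : ℝ) ^ (-α) = 0 := by simp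
      rw [ContinuousWithinAt, h2]
      refine squeeze_zero_norm' ?_ h1
      filter_upwards [self_mem_nhdsWithin] with v hv
      rcases hv.1.eq_or_lt with rfl | hv0
      · simp only [h2, norm_zero]
        positivity
      · have h3 := (hK x v hv0).trans (mul_le_mul_of_nonneg_left (min_le_right 1 v) hK0)
        rw [norm_mul, Real.norm_eq_abs (v ^ (-α)), abs_of_pos (Real.rpow_pos_of_pos hv0 _),
          abs_of_pos hv0, sub_eq_add_neg 1 α, Real.rpow_add hv0, Real.rpow_one, ← mul_assoc]
        gcongr
    · refine ContinuousAt.continuousWithinAt (ContinuousAt.mul (by fun_prop) ?_)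
      exact Real.continuousAt_rpow_const _ _ (Or.inl hu0.ne')
  have hder : ∀ u ∈ Set.Ioo 0 M, HasDerivAt (fun u => (f (x - u) - f x) * u ^ (-α))
      (-(deriv f (x - u) * u ^ (-α))
        - Real.Gamma (1 - α) * (caputoDensity α u • (f (x - u) - f x))) u := by
    intro u hu
    have h1 : HasDerivAt (fun u => f (x - u) - f x) (-deriv f (x - u)) u := by
      have := (hf.hasDerivAt (x - u)).comp u ((hasDerivAt_id u).const_sub x)
      simpa using this.sub_const (f x)
    have h2 := Real.hasDerivAt_rpow_const (p := -α) (Or.inl hu.1.ne')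
    refine (h1.mul h2).congr_deriv ?_
    have hG : Real.Gamma (1 - α) ≠ 0 := (Real.Gamma_pos_of_pos (by linarith)).ne'
    rw [caputoDensity, smul_eq_mul]
    field_simp
    ring
  have hdn : IntervalIntegrable (fun u => -(deriv f (x - u) * u ^ (-α))) volume 0 M := hd.neg
  have hmain := intervalIntegral.integral_eq_sub_of_hasDerivAt_of_le hM.le hcont hder
    (hdn.sub (hw.const_mul _))
  have hG : Real.Gamma (1 - α) ≠ 0 := (Real.Gamma_pos_of_pos (by linarith)).ne'
  rw [intervalIntegral.integral_sub hdn (hw.const_mul _), intervalIntegral.integral_neg,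
    intervalIntegral.integral_const_mul] at hmain
  simp only [sub_zero, sub_self, zero_mul] at hmain
  rw [← hmain]
  field_simp
  ring

lemma caputoTrunc_eq (hα₀ : 0 < α) (hα₁ : α < 1) (hf : IsC02 f) (x : ℝ) {R : ℝ} (hR : R < x) :
    caputoTrunc α f x R = -(∫ u in 0..(x - R), caputoDensity α u • (f (x - u) - f x))
        - 1 / Real.Gamma (1 - α) * ((f R - f x) * (x - R) ^ (-α)) := by
  have h := integral_deriv_mul_rpow_neg hα₀ hα₁ hf x (sub_pos.2 hR)
  rw [sub_sub_cancel] at h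
  rw [← h, caputoTrunc]
  congr 1
  have e := intervalIntegral.integral_comp_sub_left
    (fun u => deriv f (x - u) * u ^ (-α)) x (a := R) (b := x)
  rw [sub_self] at e
  rw [← e]
  refine intervalIntegral.integral_congr fun y hy => ?_
  rw [Set.uIcc_of_le hR.le] at hy
  rw [sub_sub_cancel, Real.rpow_neg (by linarith [hy.2]), div_eq_mul_inv]

/-- After the integration by parts the integral converges absolutely, and the boundary term is a
bounded factor times `(x-R)^(-α)`. -/
lemma tendsto_caputoTrunc (hα₀ : 0 < α) (hα₁ : α < 1) (hf : IsC02 f) (x : ℝ) :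
    Tendsto (caputoTrunc α f x) atBot (𝓝 (-caputoGenerator α f x)) := by
  obtain ⟨K, hK0, hK, -⟩ := hf.exists_bound_sub
  obtain ⟨B, hB0, hB⟩ := hf.2.1.exists_bound
  have hfc : Continuous f := hf.2.1.1
  have hx : Tendsto (fun R : ℝ => x - R) atBot atTop :=
    tendsto_atTop_add_const_left _ _ tendsto_neg_atBot_atTop
  have h1 := intervalIntegral_tendsto_integral_Ioi 0
    (integrableOn_caputoDensity_smul hα₀ hα₁ (F := fun u => f (x - u) - f x) (by fun_prop) (hK x))
    hx
  have h2 : Tendsto (fun R => 1 / Real.Gamma (1 - α) * ((f R - f x) * (x - R) ^ (-α))) atBot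
      (𝓝 0) := by
    have h3 : Tendsto (fun R => (x - R) ^ (-α)) atBot (𝓝 0) :=
      (tendsto_rpow_neg_atTop hα₀).comp hx
    have h4 : Tendsto (fun R => (f R - f x) * (x - R) ^ (-α)) atBot (𝓝 0) := by
      refine bdd_le_mul_tendsto_zero' (2 * B) (Eventually.of_forall fun R => ?_) h3
      refine (abs_sub _ _).trans ?_
      linarith [hB R, hB x]
    simpa using h4.const_mul (1 / Real.Gamma (1 - α))
  have h5 := h1.neg.sub h2
  rw [sub_zero] at h5
  refine h5.congr' ?_
  filter_upwards [eventually_lt_atBot x] with R hR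
  exact (caputoTrunc_eq hα₀ hα₁ hf x hR).symm

lemma caputoConverges (hα₀ : 0 < α) (hα₁ : α < 1) (hf : IsC02 f) (x : ℝ) :
    CaputoConverges α f x := by
  refine ⟨fun R hR => ?_, _, tendsto_caputoTrunc hα₀ hα₁ hf x⟩
  have hdc : Continuous (deriv f) := hf.2.2.1.1
  have h := (intervalIntegrable_mul_rpow_neg (g := fun u => deriv f (x - u)) (by fun_prop) hα₁
    (x - R) (x - x)).comp_sub_left x
  simp only [sub_sub_cancel] at h
  refine h.congr fun y hy => ?_
  rw [Set.uIoc_of_le hR] at hy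
  rw [Real.rpow_neg (by linarith [hy.2]), div_eq_mul_inv]

lemma caputo_eq (hα₀ : 0 < α) (hα₁ : α < 1) (hf : IsC02 f) (x : ℝ) :
    caputo α f x = -caputoGenerator α f x :=
  (tendsto_caputoTrunc hα₀ hα₁ hf x).limUnder_eq

lemma caputoDiffusion_eq (hα₀ : 0 < α) (hα₁ : α < 1) (γ₁ γ₂ : ℝ) (hf : IsC02 f) (x : ℝ) :
    caputoDiffusion α γ₁ γ₂ f x = -γ₁ * caputoGenerator α f x + γ₂ * deriv (deriv f) x := by
  rw [caputoDiffusion, caputo_eq hα₀ hα₁ hf]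
  ring

end Caputo

/-! ### The Lévy operators among the operators `γ₁ D^α + γ₂ ∂²` -/

section Levy

variable {α γ₁ γ₂ : ℝ}

/-- The Lévy measure of `-c D^α`, which lives on the negative half-line. -/
noncomputable def caputoLevyMeasure (α c : ℝ) : Measure ℝ :=
  ((volume.restrict (Set.Ioi 0)).withDensity
    fun u => ENNReal.ofReal (c * caputoDensity α u)).map (MeasurableEquiv.neg ℝ)

lemma measurable_ofReal_mul_caputoDensity (α c : ℝ) :
    Measurable fun u => ENNReal.ofReal (c * caputoDensity α u) :=
  (measurable_caputoDensity.const_mul c).ennreal_ofReal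

lemma integral_caputoLevyMeasure (hα₀ : 0 < α) (hα₁ : α < 1) {c : ℝ} (hc : 0 ≤ c) (g : ℝ → ℝ) :
    ∫ y, g y ∂(caputoLevyMeasure α c)
      = c * ∫ u in Set.Ioi (0 : ℝ), caputoDensity α u • g (-u) := by
  rw [caputoLevyMeasure, integral_map_equiv, integral_withDensity_eq_integral_toReal_smul
    (measurable_ofReal_mul_caputoDensity α c) (ae_of_all _ fun _ => ENNReal.ofReal_lt_top),
    ← integral_const_mul]
  refine setIntegral_congr_fun measurableSet_Ioi fun u hu => ?_
  simp only [MeasurableEquiv.neg_apply, smul_eq_mul]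
  rw [ENNReal.toReal_ofReal (mul_nonneg hc (caputoDensity_pos hα₀ hα₁ hu).le), mul_assoc]

lemma isLevyMeasure_caputoLevyMeasure (hα₀ : 0 < α) (hα₁ : α < 1) {c : ℝ} (hc : 0 ≤ c) :
    IsLevyMeasure (caputoLevyMeasure α c) := by
  constructor
  · rw [caputoLevyMeasure, MeasurableEquiv.map_apply]
    refine (withDensity_absolutelyContinuous _ _) ?_
    refine nonpos_iff_eq_zero.1 ((Measure.restrict_apply_le _ _).trans ?_)
    simp
  · rw [caputoLevyMeasure, lintegral_map_equiv, lintegral_withDensity_eq_lintegral_mul _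
      (measurable_ofReal_mul_caputoDensity α c) (by fun_prop)]
    have h := ((integrableOn_min_mul_caputoDensity hα₀ hα₁).const_mul c).lintegral_lt_top
    refine lt_of_le_of_lt (setLIntegral_mono' measurableSet_Ioi fun u (hu : 0 < u) => ?_) h
    have h0 := (caputoDensity_pos hα₀ hα₁ hu).le
    simp only [Pi.mul_apply, MeasurableEquiv.neg_apply, neg_sq]
    rw [← ENNReal.ofReal_mul (mul_nonneg hc h0)]
    refine ENNReal.ofReal_le_ofReal ?_
    have h1 : min 1 (u ^ 2) ≤ min 1 u := by
      rcases le_total 1 u with h | h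
      · rw [min_eq_left h]
        exact min_le_left _ _
      · rw [min_eq_right h]
        exact (min_le_right _ _).trans (by nlinarith)
    calc c * caputoDensity α u * min 1 (u ^ 2) ≤ c * caputoDensity α u * min 1 u := by gcongr
      _ = _ := by ring

lemma isLevyOperator_caputoDiffusion (hα₀ : 0 < α) (hα₁ : α < 1) (h₁ : γ₁ ≤ 0) (h₂ : 0 ≤ γ₂) :
    IsLevyOperator (caputoDiffusion α γ₁ γ₂) := by
  let χ : ℝ → ℝ := fun u => u * (Set.Ioo (-1 : ℝ) 1).indicator (fun _ => (1 : ℝ)) (-u)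
  have hχ : IntegrableOn (fun u => caputoDensity α u * χ u) (Set.Ioi 0) := by
    refine (integrableOn_min_mul_caputoDensity hα₀ hα₁).mono' (Measurable.aestronglyMeasurable
      (measurable_caputoDensity.mul (measurable_id.mul
        ((measurable_const.indicator measurableSet_Ioo).comp measurable_neg)))) ?_
    refine (ae_restrict_iff' measurableSet_Ioi).2 (ae_of_all _ fun u (hu : 0 < u) => ?_)
    have h0 := caputoDensity_pos hα₀ hα₁ hu
    rw [norm_mul, Real.norm_eq_abs, abs_of_pos h0, mul_comm]
    gcongr
    by_cases h : -u ∈ Set.Ioo (-1 : ℝ) 1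
    · have hu1 : u ≤ 1 := by linarith [h.1]
      simp [χ, Set.indicator_of_mem h, abs_of_pos hu, hu1]
    · simp [χ, Set.indicator_of_notMem h, hu.le]
  -- The Lévy form subtracts the truncated drift although `ν` needs no compensation; `γ` is chosen
  -- to cancel exactly that term.
  refine ⟨2 * γ₂, γ₁ * ∫ u in Set.Ioi (0 : ℝ), caputoDensity α u * χ u,
    caputoLevyMeasure α (-γ₁), by positivity,
    isLevyMeasure_caputoLevyMeasure hα₀ hα₁ (by linarith), fun f hf x => ?_⟩
  obtain ⟨K, hK0, hK, -⟩ := hf.exists_bound_sub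
  have hfc : Continuous f := hf.2.1.1
  have hint := integrableOn_caputoDensity_smul hα₀ hα₁ (F := fun u => f (x - u) - f x)
    (by fun_prop) (hK x)
  rw [caputoDiffusion_eq hα₀ hα₁ _ _ hf, integral_caputoLevyMeasure hα₀ hα₁ (by linarith)]
  have e : ∫ u in Set.Ioi (0 : ℝ), caputoDensity α u • (f (x + -u) - f x
      - -u * deriv f x * (Set.Ioo (-1 : ℝ) 1).indicator (fun _ => (1 : ℝ)) (-u))
      = caputoGenerator α f x
        + deriv f x * ∫ u in Set.Ioi (0 : ℝ), caputoDensity α u * χ u := by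
    rw [caputoGenerator, ← integral_const_mul, ← integral_add hint (hχ.const_mul _)]
    refine integral_congr_ae (ae_of_all _ fun u => ?_)
    simp only [χ, smul_eq_mul, ← sub_eq_add_neg]
    ring
  rw [e]
  ring

/-- The positive maximum principle. -/
lemma IsLevyOperator.nonpos {L : (ℝ → ℝ) → ℝ → ℝ} (hL : IsLevyOperator L) {f : ℝ → ℝ}
    (hf : IsC02 f) (h1 : deriv f 0 = 0) (h2 : deriv (deriv f) 0 ≤ 0) (hmax : ∀ y, f y ≤ f 0) :
    L f 0 ≤ 0 := by
  obtain ⟨A, γ, ν, hA, -, h⟩ := hL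
  rw [h f hf 0, h1]
  have : ∫ y, (f (0 + y) - f 0 - y * 0 * (Set.Ioo (-1 : ℝ) 1).indicator (fun _ => (1 : ℝ)) y) ∂ν
      ≤ 0 := by
    refine integral_nonpos fun y => ?_
    have := hmax y
    simp only [zero_add, mul_zero, zero_mul, sub_zero, Pi.zero_apply]
    linarith
  nlinarith [mul_nonneg hA (neg_nonneg.2 h2)]

/-- The function `(1+x²)exp(-x²)` has a strict global maximum at `0` with vanishing second
derivative, so only the nonlocal term is tested there, and `caputoGenerator` is strictly negative.
-/
lemma nonpos_of_isLevyOperator (hα₀ : 0 < α) (hα₁ : α < 1)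
    (hL : IsLevyOperator (caputoDiffusion α γ₁ γ₂)) : γ₁ ≤ 0 := by
  have hf : IsC02 (polyGauss 1 (1 + Polynomial.X ^ 2)) := isC02_polyGauss one_pos _
  set f := polyGauss 1 (1 + Polynomial.X ^ 2) with hfdef
  have h1 : deriv f 0 = 0 := by
    rw [hfdef, deriv_polyGauss]
    simp [polyGauss]
  have h2 : deriv (deriv f) 0 = 0 := by
    rw [hfdef, deriv_polyGauss, deriv_polyGauss]
    norm_num [polyGauss]
  have h0 : f 0 = 1 := by simp [hfdef, polyGauss]
  have hval : ∀ y, f y = (1 + y ^ 2) * Real.exp (-y ^ 2) := fun y => by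
    simp [hfdef, polyGauss]
  have hlt : ∀ y, y ≠ 0 → f y < 1 := fun y hy => by
    rw [hval, Real.exp_neg, ← div_eq_mul_inv, div_lt_one (Real.exp_pos _)]
    have := Real.add_one_lt_exp (x := y ^ 2) (by positivity)
    linarith
  have hmax : ∀ y, f y ≤ f 0 := fun y => by
    rcases eq_or_ne y 0 with rfl | hy
    · exact le_rfl
    · rw [h0]
      exact (hlt y hy).le
  have h := hL.nonpos hf h1 h2.le hmax
  rw [caputoDiffusion_eq hα₀ hα₁ _ _ hf, h2, mul_zero, add_zero] at h
  obtain ⟨K, hK0, hK, -⟩ := hf.exists_bound_sub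
  have hfc : Continuous f := hf.2.1.1
  have hint := integrableOn_caputoDensity_smul hα₀ hα₁ (F := fun u => f (0 - u) - f 0)
    (by fun_prop) (hK 0)
  have hneg : 0 < ∫ u in Set.Ioi (0 : ℝ), -(caputoDensity α u • (f (0 - u) - f 0)) := by
    rw [setIntegral_pos_iff_support_of_nonneg_ae]
    · have : Function.support (fun u => -(caputoDensity α u • (f (0 - u) - f 0))) ∩ Set.Ioi 0
          = Set.Ioi 0 := by
        refine Set.inter_eq_right.2 fun u (hu : 0 < u) => ?_
        have hd := caputoDensity_pos hα₀ hα₁ hu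
        have hl := hlt (0 - u) (by linarith)
        rw [Function.mem_support, smul_eq_mul, h0]
        nlinarith
      rw [this]
      simp
    · refine (ae_restrict_iff' measurableSet_Ioi).2 (ae_of_all _ fun u (hu : 0 < u) => ?_)
      have hd := caputoDensity_pos hα₀ hα₁ hu
      have := hmax (0 - u)
      simp only [Pi.zero_apply, smul_eq_mul]
      nlinarith
    · exact hint.neg
  rw [integral_neg] at hneg
  have hg : caputoGenerator α f 0 < 0 := by
    rw [caputoGenerator]
    linarith
  by_contra! hpos
  nlinarith

/-- For `exp(-s²x²)` the second derivative at `0` is `-2s²` but the nonlocal term is only `O(s)`;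
after division by `s`, large `s` isolates the sign of `γ₂`. -/
lemma nonneg_of_isLevyOperator (hα₀ : 0 < α) (hα₁ : α < 1)
    (hL : IsLevyOperator (caputoDiffusion α γ₁ γ₂)) : 0 ≤ γ₂ := by
  have key : ∀ s : ℝ, 1 ≤ s → -(|γ₁| * caputoMass α) ≤ 2 * s * γ₂ := by
    intro s hs
    have hs0 : 0 < s := by linarith
    have hf : IsC02 (polyGauss (s ^ 2) 1) := isC02_polyGauss (by positivity) _
    set f := polyGauss (s ^ 2) 1 with hfdef
    have h1 : deriv f 0 = 0 := by
      rw [hfdef, deriv_polyGauss]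
      simp [polyGauss]
    have h2 : deriv (deriv f) 0 = -(2 * s ^ 2) := by
      rw [hfdef, deriv_polyGauss, deriv_polyGauss]
      simp [polyGauss]
    have h0 : f 0 = 1 := by simp [hfdef, polyGauss]
    have hval : ∀ y, f y = Real.exp (-(s * y) ^ 2) := fun y => by
      simp [hfdef, polyGauss, mul_pow]
    have hmax : ∀ y, f y ≤ f 0 := fun y => by
      rw [h0, hval, Real.exp_le_one_iff]
      nlinarith [sq_nonneg (s * y)]
    have h := hL.nonpos hf h1 (by rw [h2]; nlinarith) hmax
    rw [caputoDiffusion_eq hα₀ hα₁ _ _ hf, h2] at h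
    -- The increment is at most `min(1,(su)²) ≤ su`, and also at most `1 ≤ s`.
    have hK : ∀ u, 0 < u → ‖f (0 - u) - f 0‖ ≤ s * min 1 u := by
      intro u hu
      have e1 : 1 - f (0 - u) ≤ (s * u) ^ 2 := by
        rw [hval]
        have := Real.add_one_le_exp (-(s * (0 - u)) ^ 2)
        nlinarith
      have e2 : 0 ≤ f (0 - u) := by rw [hval]; positivity
      have e3 := hmax (0 - u)
      have hsu : 0 < s * u := by positivity
      rw [h0] at e3 ⊢
      rw [norm_sub_rev, Real.norm_eq_abs, abs_of_nonneg (by linarith)]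
      refine (le_mul_min_one (b := s) (K := s) (by linarith) ?_ hu).trans (by rw [max_self])
      rcases le_total (s * u) 1 with h | h <;> nlinarith
    have hb := norm_integral_caputoDensity_smul_le hα₀ hα₁ hK measurableSet_Ioi le_rfl
    change |caputoGenerator α f 0| ≤ s * caputoMass α at hb
    have hb2 : |γ₁ * caputoGenerator α f 0| ≤ |γ₁| * (s * caputoMass α) := by
      rw [abs_mul]
      gcongr
    have hb3 := (abs_le.1 hb2).2
    have h3 : s * -(|γ₁| * caputoMass α) ≤ s * (2 * s * γ₂) := by nlinarith
    exact le_of_mul_le_mul_left h3 hs0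
  by_contra! hneg
  -- This `s` makes `2sγ₂ ≤ -(|γ₁| * caputoMass α + 1)`, against `key`.
  have hc := key (max 1 ((|γ₁| * caputoMass α + 1) / (-2 * γ₂))) (le_max_left _ _)
  have hs := le_max_right 1 ((|γ₁| * caputoMass α + 1) / (-2 * γ₂))
  rw [div_le_iff₀ (by linarith)] at hs
  linarith

lemma isLevyOperator_caputoDiffusion_iff (hα₀ : 0 < α) (hα₁ : α < 1) :
    IsLevyOperator (caputoDiffusion α γ₁ γ₂) ↔ γ₁ ≤ 0 ∧ 0 ≤ γ₂ :=
  ⟨fun h => ⟨nonpos_of_isLevyOperator hα₀ hα₁ h, nonneg_of_isLevyOperator hα₀ hα₁ h⟩,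
    fun h => isLevyOperator_caputoDiffusion hα₀ hα₁ h.1 h.2⟩

end Levy

/-! ### Generators of the stable and the Gaussian semigroup -/

/-- Laws whose characteristic function is close to `1` hardly move a uniformly continuous bounded
function. -/
lemma exists_abs_convOp_sub_le_of_charFun {g : ℝ → ℝ} {B : ℝ} (hg : UniformContinuous g)
    (hB : ∀ x, |g x| ≤ B) {D : ℝ → ℝ} (hD : Continuous D) {η : ℝ} (hη : 0 < η) :
    ∃ t₀ > 0, ∀ t, 0 ≤ t → t ≤ t₀ → ∀ μ : Measure ℝ, IsProbabilityMeasure μ →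
      (∀ k, ‖1 - charFun μ k‖ ≤ t * D k) → ∀ x, |convOp μ g x - g x| ≤ η := by
  obtain ⟨δ, hδ, θ, hθ, h⟩ := exists_abs_convOp_sub_le hg hB hη
  obtain ⟨C, hC⟩ := (isCompact_Icc (a := -(2 / δ)) (b := 2 / δ)).exists_bound_of_continuousOn
    hD.continuousOn
  have hC0 : 0 ≤ C := (norm_nonneg _).trans (hC 0 ⟨by simp; positivity, by positivity⟩)
  refine ⟨θ / (2 * (C + 1)), by positivity, fun t ht ht₀ μ hμ hμD => h μ hμ ?_⟩
  refine (measureReal_abs_gt_le_of_charFun (b := t * C) hδ fun k hk => ?_).trans ?_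
  · refine (hμD k).trans (mul_le_mul_of_nonneg_left ?_ ht)
    exact (le_abs_self _).trans (hC k (abs_le.1 hk))
  · rw [le_div_iff₀ (by positivity)] at ht₀
    nlinarith

section StableGenerator

variable {α : ℝ} {f : ℝ → ℝ}

lemma abs_caputoGenerator_le (hα₀ : 0 < α) (hα₁ : α < 1) {K : ℝ}
    (hK : ∀ x u, 0 < u → ‖f (x - u) - f x‖ ≤ K * min 1 u) (x : ℝ) :
    |caputoGenerator α f x| ≤ K * caputoMass α :=
  norm_integral_caputoDensity_smul_le hα₀ hα₁ (hK x) measurableSet_Ioi le_rfl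

lemma abs_convOp_paretoStep_sub_le (hα₀ : 0 < α) (hα₁ : α < 1) {K : ℝ} (hf : IsC02 f)
    (hK : ∀ x u, 0 < u → ‖f (x - u) - f x‖ ≤ K * min 1 u) {h : ℝ} (hh : 0 < h) (x : ℝ) :
    |convOp (paretoStep α h) f x - f x - h * caputoGenerator α f x|
      ≤ h * (K * stepError α h) := by
  have := isProbabilityMeasure_paretoStep hα₀ hα₁ hh
  obtain ⟨B, -, hB⟩ := hf.2.1.exists_bound
  have hfc : Continuous f := hf.2.1.1
  have h1 := norm_integral_paretoStep_sub_le hα₀ hα₁ hh (F := fun u => f (x - u) - f x)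
    (by fun_prop) (hK x)
  rw [integral_sub (integrable_comp_sub hfc hB x) (integrable_const _), integral_const,
    probReal_univ, one_smul] at h1
  exact h1

/-- `G f` is a uniform limit of the Pareto difference quotients of `f`, each of which is Lipschitz.
Uniform continuity is what lets laws near `δ₀` move `G f` little. -/
lemma uniformContinuous_caputoGenerator (hα₀ : 0 < α) (hα₁ : α < 1) (hf : IsC02 f) :
    UniformContinuous (caputoGenerator α f) := by
  obtain ⟨K, hK0, hK, hL⟩ := hf.exists_bound_sub
  obtain ⟨B, -, hB⟩ := hf.2.1.exists_bound
  have hfc : Continuous f := hf.2.1.1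
  rw [Metric.uniformContinuous_iff]
  intro ε hε
  have hlim : Tendsto (fun h => K * stepError α h) (𝓝[>] 0) (𝓝 0) := by
    have := (tendsto_stepError hα₀ hα₁).const_mul K
    rw [mul_zero] at this
    exact this.mono_left nhdsWithin_le_nhds
  obtain ⟨h, herr, hh⟩ := ((hlim.eventually_lt_const (show 0 < ε / 4 by positivity)).and
    self_mem_nhdsWithin).exists
  have hh' : (0 : ℝ) < h := hh
  refine ⟨ε * h / (4 * (K + 1)), by positivity, fun {x y} hxy => ?_⟩
  have := isProbabilityMeasure_paretoStep hα₀ hα₁ hh'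
  have h1 := abs_convOp_paretoStep_sub_le hα₀ hα₁ hf hK hh' x
  have h2 := abs_convOp_paretoStep_sub_le hα₀ hα₁ hf hK hh' y
  rw [Real.dist_eq] at hxy ⊢
  have h3 : |convOp (paretoStep α h) f x - convOp (paretoStep α h) f y| ≤ K * |x - y| := by
    rw [convOp, convOp, ← integral_sub (integrable_comp_sub hfc hB x) (integrable_comp_sub hfc hB y)]
    have := norm_integral_le_of_norm_le_const (μ := paretoStep α h)
      (f := fun u => f (x - u) - f (y - u)) (C := K * |x - y|) (ae_of_all _ fun u => by
        have := hL (x - u) (y - u)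
        rwa [sub_sub_sub_cancel_right] at this)
    simpa using this
  have h4 := hL x y
  rw [lt_div_iff₀ (by positivity)] at hxy
  have h5 : h * (K * stepError α h) ≤ h * (ε / 4) := by gcongr
  have h6 : K * |x - y| < h * (ε / 4) := by nlinarith [abs_nonneg (x - y)]
  have h7 : |h * (caputoGenerator α f x - caputoGenerator α f y)| < h * ε := by
    rw [abs_le] at h1 h2 h3 h4
    rw [abs_lt]
    constructor <;> linarith
  rw [abs_mul, abs_of_pos hh'] at h7
  exact lt_of_mul_lt_mul_left h7 hh'.le

/-- The generator of the one-sided stable semigroup. -/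
lemma exists_abs_convOp_rieszFellerLaw_sub_le (hα₀ : 0 < α) (hα₁ : α < 1) (hf : IsC02 f) {ε : ℝ}
    (hε : 0 < ε) :
    ∃ t₀ > 0, ∀ τ, 0 ≤ τ → τ ≤ t₀ → ∀ x,
      |convOp (rieszFellerLaw α (-α) τ) f x - f x - τ * caputoGenerator α f x| ≤ τ * ε := by
  obtain ⟨K, hK0, hK, hL⟩ := hf.exists_bound_sub
  obtain ⟨B, -, hB⟩ := hf.2.1.exists_bound
  have hfc : Continuous f := hf.2.1.1
  have hgu := uniformContinuous_caputoGenerator hα₀ hα₁ hf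
  have hgb := abs_caputoGenerator_le hα₀ hα₁ hK
  obtain ⟨t₀, ht₀, hsmall⟩ := exists_abs_convOp_sub_le_of_charFun hgu hgb
    (D := fun k => max 2 |k| * caputoMass α) (by fun_prop) hε
  refine ⟨t₀, ht₀, fun τ hτ hτt x => ?_⟩
  rcases hτ.eq_or_lt with rfl | hτ
  · simp [rieszFellerLaw]
  -- The bound holds with the same `ε` for every `n`: all partial sums of steps cover time at most
  -- `τ`, so they move `G f` by at most `ε`.
  have hstep : ∀ n : ℕ, |convOp (convPow (paretoStep α (τ / (n + 1 : ℕ))) (n + 1)) f x - f x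
      - τ * caputoGenerator α f x| ≤ τ * (K * stepError α (τ / (n + 1 : ℕ)) + ε) := by
    intro n
    have hh : 0 < τ / (n + 1 : ℕ) := by positivity
    have hnh : ((n + 1 : ℕ) : ℝ) * (τ / (n + 1 : ℕ)) = τ := by field_simp
    have := isProbabilityMeasure_paretoStep hα₀ hα₁ hh
    have h := abs_convPow_sub_sub_le hfc hB hgu.continuous hgb hh.le
      (abs_convOp_paretoStep_sub_le hα₀ hα₁ hf hK hh) (n + 1) (η' := ε) (fun j hj => ?_) x
    · rwa [hnh] at h
    refine hsmall (j * (τ / (n + 1 : ℕ))) (by positivity) (le_trans ?_ hτt) _ inferInstance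
      fun k => ?_
    · calc (j : ℝ) * (τ / (n + 1 : ℕ)) ≤ ((n + 1 : ℕ) : ℝ) * (τ / (n + 1 : ℕ)) := by gcongr
        _ = τ := hnh
    · rw [charFun_convPow, mul_assoc]
      refine (norm_one_sub_pow_le (norm_charFun_le_one k) j).trans ?_
      gcongr
      exact norm_one_sub_charFun_paretoStep_le hα₀ hα₁ hh le_rfl
  -- Weak convergence is used at fixed `x`; uniformity in `x` is already in the bound.
  have hweak := ProbabilityMeasure.tendsto_iff_forall_integral_tendsto.1
    (tendsto_convPow_paretoStep hα₀ hα₁ hτ)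
    (BoundedContinuousFunction.ofNormedAddCommGroup (fun y => f (x - y)) (by fun_prop) B
      fun y => hB (x - y))
  have hz : Tendsto (fun n : ℕ => τ / ((n + 1 : ℕ) : ℝ)) atTop (𝓝 0) :=
    (tendsto_const_div_atTop_nhds_zero_nat τ).comp (tendsto_add_atTop_nat 1)
  have hR : Tendsto (fun n : ℕ => τ * (K * stepError α (τ / (n + 1 : ℕ)) + ε)) atTop
      (𝓝 (τ * (K * 0 + ε))) :=
    ((((tendsto_stepError hα₀ hα₁).comp hz).const_mul K).add_const ε).const_mul τ
  rw [mul_zero, zero_add] at hR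
  exact le_of_tendsto_of_tendsto' ((hweak.sub_const _).sub_const _).abs hR hstep

end StableGenerator

section GaussianGenerator

variable {f : ℝ → ℝ}

/-- The second order Taylor estimate. -/
lemma abs_taylor_two_le {f f' f'' : ℝ → ℝ} (h1 : ∀ x, HasDerivAt f (f' x) x)
    (h2 : ∀ x, HasDerivAt f' (f'' x) x) {x y E : ℝ}
    (hE : ∀ z, |z - x| ≤ |y| → |f'' z - f'' x| ≤ E) :
    |f (x - y) - f x + y * f' x - y ^ 2 / 2 * f'' x| ≤ E * y ^ 2 := by
  have hconv : Convex ℝ (Metric.closedBall x |y|) := convex_closedBall x |y|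
  have hx : x ∈ Metric.closedBall x |y| := Metric.mem_closedBall_self (abs_nonneg y)
  have hxy : x - y ∈ Metric.closedBall x |y| := by
    rw [Metric.mem_closedBall, Real.dist_eq]
    simp
  have hE0 : 0 ≤ E := (abs_nonneg _).trans (hE x (by simp))
  -- The mean value inequality is applied twice, first to `f'` and then to `f`; this loses a factor
  -- `2` against the sharp remainder, which is harmless.
  have hq : ∀ z ∈ Metric.closedBall x |y|, |f' z - f' x - (z - x) * f'' x| ≤ E * |y| := by
    intro z hz
    have h := hconv.norm_image_sub_le_of_norm_hasDerivWithin_le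
      (f := fun z => f' z - (z - x) * f'' x) (f' := fun z => f'' z - f'' x) (C := E) (x := x)
      (y := z) (fun w _ => ?_) (fun w hw => hE w (by rwa [← Real.dist_eq])) hx hz
    · simp only [sub_self, zero_mul, sub_zero] at h
      rw [show f' z - f' x - (z - x) * f'' x = f' z - (z - x) * f'' x - f' x by ring]
      refine h.trans ?_
      gcongr
      rw [← dist_eq_norm]
      exact hz
    · refine HasDerivAt.hasDerivWithinAt ?_
      refine ((h2 w).sub (((hasDerivAt_id w).sub_const x).mul_const (f'' x))).congr_deriv ?_
      simp
  have h := hconv.norm_image_sub_le_of_norm_hasDerivWithin_le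
    (f := fun z => f z - (z - x) * f' x - (z - x) ^ 2 / 2 * f'' x)
    (f' := fun z => f' z - f' x - (z - x) * f'' x) (C := E * |y|) (x := x)
    (y := x - y) (fun w _ => ?_) hq hx hxy
  · simp only [sub_self, zero_mul, sub_zero] at h
    calc |f (x - y) - f x + y * f' x - y ^ 2 / 2 * f'' x|
        = ‖f (x - y) - (x - y - x) * f' x - (x - y - x) ^ 2 / 2 * f'' x
          - (f x - 0 ^ 2 / 2 * f'' x)‖ := by
          rw [Real.norm_eq_abs]
          congr 1
          ring
      _ ≤ E * |y| * ‖x - y - x‖ := h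
      _ = E * y ^ 2 := by
          rw [show x - y - x = -y by ring, norm_neg, Real.norm_eq_abs, mul_assoc, ← sq, sq_abs]
  · refine HasDerivAt.hasDerivWithinAt ?_
    have d := (hasDerivAt_id w).sub_const x
    refine (((h1 w).sub (d.mul_const (f' x))).sub
      (((d.pow 2).div_const 2).mul_const (f'' x))).congr_deriv ?_
    simp

lemma integrable_pow_gaussianReal (v : ℝ≥0) (n : ℕ) :
    Integrable (fun y => y ^ n) (gaussianReal 0 v) := by
  have h := (memLp_id_gaussianReal' (μ := 0) (v := v) n (by simp)).integrable_norm_pow'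
  refine (integrable_norm_iff (by fun_prop)).1 (h.congr (ae_of_all _ fun y => ?_))
  simp

lemma integral_sq_gaussianReal (v : ℝ≥0) : ∫ y, y ^ 2 ∂(gaussianReal 0 v) = v := by
  have h := variance_eq_sub (memLp_id_gaussianReal (μ := 0) (v := v) 2)
  rw [variance_id_gaussianReal] at h
  simpa using h.symm

/-- Scaling by `√v`. Only the order `v²` matters, so the standard moment is left unevaluated. -/
lemma integral_pow_four_gaussianReal (v : ℝ≥0) :
    ∫ y, y ^ 4 ∂(gaussianReal 0 v) = v ^ 2 * ∫ y, y ^ 4 ∂(gaussianReal 0 1) := by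
  have h : gaussianReal 0 v = (gaussianReal 0 1).map (√v * ·) := by
    rw [gaussianReal_map_const_mul]
    congr 1
    · simp
    · ext
      simp
  rw [h, integral_map (by fun_prop) (by fun_prop), ← integral_const_mul]
  refine integral_congr_ae (ae_of_all _ fun y => ?_)
  simp only
  rw [mul_pow, show (√(v : ℝ)) ^ 4 = ((√(v : ℝ)) ^ 2) ^ 2 by ring, Real.sq_sqrt v.coe_nonneg]

/-- The generator of the Gaussian semigroup. -/
lemma exists_abs_convOp_gaussianReal_sub_le (hf : IsC02 f) {ε : ℝ} (hε : 0 < ε) :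
    ∃ t₀ > 0, ∀ v : ℝ≥0, (v : ℝ) ≤ t₀ → ∀ x,
      |convOp (gaussianReal 0 v) f x - f x - v / 2 * deriv (deriv f) x| ≤ v * ε := by
  obtain ⟨B, -, hB⟩ := hf.2.1.exists_bound
  obtain ⟨C, hC0, hC⟩ := hf.2.2.2.exists_bound
  have hfc : Continuous f := hf.2.1.1
  have hd2 : ∀ x, HasDerivAt (deriv f) (deriv (deriv f) x) x := fun x =>
    ((hf.1.differentiable_deriv_two) x).hasDerivAt
  obtain ⟨δ, hδ, hu⟩ := Metric.uniformContinuous_iff.1 hf.2.2.2.uniformContinuous (ε / 2)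
    (by positivity)
  set M := ∫ y, y ^ 4 ∂(gaussianReal 0 1) with hM
  have hM0 : 0 ≤ M := integral_nonneg fun y => by positivity
  -- For `|y| > δ/2` one has `1 ≤ 4y²/δ²`, which turns the crude remainder `2C y²` into `c y⁴`. Its
  -- expectation is `O(v²)`, negligible against `v`.
  set c := 8 * C / δ ^ 2 with hc
  have hc0 : 0 ≤ c := by positivity
  refine ⟨ε / (2 * (c * M + 1)), by positivity, fun v hv x => ?_⟩
  have hbound : ∀ y, |f (x - y) - f x + y * deriv f x - y ^ 2 / 2 * deriv (deriv f) x|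
      ≤ ε / 2 * y ^ 2 + c * y ^ 4 := by
    intro y
    by_cases hy : |y| ≤ δ / 2
    · have := abs_taylor_two_le hf.hasDerivAt hd2 (x := x) (y := y) (E := ε / 2) fun z hz => by
        have := hu (a := z) (b := x) (by rw [Real.dist_eq]; linarith)
        exact this.le
      have h4 : 0 ≤ c * y ^ 4 := by positivity
      linarith
    · have := abs_taylor_two_le hf.hasDerivAt hd2 (x := x) (y := y) (E := 2 * C) fun z hz => by
        refine (abs_sub _ _).trans ?_
        linarith [hC z, hC x]
      have h5 : δ ^ 2 / 4 ≤ y ^ 2 := by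
        rw [← sq_abs y]
        nlinarith [not_le.1 hy]
      have h6 : 2 * C * y ^ 2 ≤ c * y ^ 4 := by
        rw [hc, div_mul_eq_mul_div, le_div_iff₀ (by positivity)]
        nlinarith [mul_nonneg hC0 (sq_nonneg y), mul_le_mul_of_nonneg_left h5
          (mul_nonneg hC0 (sq_nonneg y))]
      have h7 : 0 ≤ ε / 2 * y ^ 2 := by positivity
      linarith
  have hi1 := integrable_pow_gaussianReal v 1
  have hi2 := integrable_pow_gaussianReal v 2
  have hi4 := integrable_pow_gaussianReal v 4
  simp only [pow_one] at hi1
  have hif := integrable_comp_sub (μ := gaussianReal 0 v) hfc hB x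
  have hfx : Integrable (fun y => f (x - y) - f x) (gaussianReal 0 v) :=
    hif.sub (integrable_const _)
  have hlin : Integrable (fun y => y * deriv f x) (gaussianReal 0 v) := hi1.mul_const _
  have hquad : Integrable (fun y => y ^ 2 / 2 * deriv (deriv f) x) (gaussianReal 0 v) :=
    (hi2.div_const 2).mul_const _
  have hadd : Integrable (fun y => f (x - y) - f x + y * deriv f x) (gaussianReal 0 v) :=
    hfx.add hlin
  have e : convOp (gaussianReal 0 v) f x - f x - v / 2 * deriv (deriv f) x
      = ∫ y, (f (x - y) - f x + y * deriv f x - y ^ 2 / 2 * deriv (deriv f) x)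
        ∂(gaussianReal 0 v) := by
    rw [integral_sub hadd hquad, integral_add hfx hlin,
      integral_sub hif (integrable_const _), integral_mul_const, integral_mul_const,
      integral_div, integral_sq_gaussianReal, integral_id_gaussianReal]
    simp [convOp]
  rw [e]
  have h8 := norm_integral_le_of_norm_le (μ := gaussianReal 0 v)
    (f := fun y => f (x - y) - f x + y * deriv f x - y ^ 2 / 2 * deriv (deriv f) x)
    (g := fun y => ε / 2 * y ^ 2 + c * y ^ 4) ((hi2.const_mul _).add (hi4.const_mul _))
    (ae_of_all _ hbound)
  rw [integral_add (hi2.const_mul _) (hi4.const_mul _), integral_const_mul, integral_const_mul,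
    integral_sq_gaussianReal, integral_pow_four_gaussianReal] at h8
  refine h8.trans ?_
  rw [le_div_iff₀ (by positivity)] at hv
  have hv0 : (0 : ℝ) ≤ v := v.2
  nlinarith [mul_nonneg hc0 hM0]

end GaussianGenerator

/-! ### The heat kernel -/

/-- The heat kernel of `-c D^α + γ ∂²`. -/
noncomputable def caputoHeatKernel (α c γ : ℝ) (t : ℝ≥0) : Measure ℝ :=
  (rieszFellerLaw α (-α) (c * t)).conv (gaussianReal 0 (Real.toNNReal (2 * γ * t)))

section HeatKernel

variable {α c γ : ℝ}

lemma isProbabilityMeasure_caputoHeatKernel (hα₀ : 0 < α) (hα₁ : α < 1) (hc : 0 ≤ c) (t : ℝ≥0) :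
    IsProbabilityMeasure (caputoHeatKernel α c γ t) := by
  have := isProbabilityMeasure_rieszFellerLaw hα₀ hα₁ (mul_nonneg hc t.coe_nonneg)
  unfold caputoHeatKernel
  infer_instance

lemma charFun_caputoHeatKernel (hα₀ : 0 < α) (hα₁ : α < 1) (hc : 0 ≤ c) (hγ : 0 ≤ γ) (t : ℝ≥0)
    (k : ℝ) : charFun (caputoHeatKernel α c γ t) k
      = Complex.exp (((c : ℝ) * rieszFellerSymbol α (-α) k - (γ * k ^ 2 : ℝ)) * (t : ℝ)) := by
  have := isProbabilityMeasure_rieszFellerLaw hα₀ hα₁ (mul_nonneg hc t.coe_nonneg)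
  rw [caputoHeatKernel, charFun_conv, charFun_rieszFellerLaw hα₀ hα₁ (mul_nonneg hc t.coe_nonneg),
    charFun_gaussianReal, ← Complex.exp_add, Real.coe_toNNReal _ (by positivity)]
  congr 1
  push_cast
  ring

lemma norm_rieszFellerSymbol (a θ k : ℝ) : ‖rieszFellerSymbol a θ k‖ = |k| ^ a := by
  rw [rieszFellerSymbol, norm_mul, norm_neg, Complex.norm_real, mul_comm Complex.I,
    Complex.norm_exp_ofReal_mul_I, mul_one, Real.norm_eq_abs, abs_of_nonneg (by positivity)]

lemma norm_one_sub_charFun_rieszFellerLaw_le (hα₀ : 0 < α) (hα₁ : α < 1) {τ : ℝ} (hτ : 0 ≤ τ)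
    (k : ℝ) : ‖1 - charFun (rieszFellerLaw α (-α) τ) k‖ ≤ τ * |k| ^ α := by
  rw [charFun_rieszFellerLaw hα₀ hα₁ hτ, norm_sub_rev]
  refine (norm_exp_sub_one_le_of_re_nonpos ?_).trans_eq ?_
  · rw [Complex.re_ofReal_mul]
    exact mul_nonpos_of_nonneg_of_nonpos hτ (re_rieszFellerSymbol_nonpos hα₀ hα₁ k)
  · rw [norm_mul, norm_rieszFellerSymbol, Complex.norm_real, Real.norm_eq_abs, abs_of_nonneg hτ]

lemma norm_one_sub_charFun_caputoHeatKernel_le (hα₀ : 0 < α) (hα₁ : α < 1) (hc : 0 ≤ c)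
    (hγ : 0 ≤ γ) (t : ℝ≥0) (k : ℝ) :
    ‖1 - charFun (caputoHeatKernel α c γ t) k‖ ≤ t * (c * |k| ^ α + γ * k ^ 2) := by
  rw [charFun_caputoHeatKernel hα₀ hα₁ hc hγ, norm_sub_rev]
  refine (norm_exp_sub_one_le_of_re_nonpos ?_).trans ?_
  · rw [mul_comm, Complex.re_ofReal_mul, Complex.sub_re, Complex.re_ofReal_mul, Complex.ofReal_re]
    have h1 := mul_nonpos_of_nonneg_of_nonpos hc (re_rieszFellerSymbol_nonpos hα₀ hα₁ k)
    have h2 : 0 ≤ γ * k ^ 2 := by positivity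
    exact mul_nonpos_of_nonneg_of_nonpos t.coe_nonneg (by linarith)
  · rw [norm_mul, mul_comm, Complex.norm_real, Real.norm_eq_abs, abs_of_nonneg t.coe_nonneg]
    gcongr
    refine (norm_sub_le _ _).trans (le_of_eq ?_)
    rw [norm_mul, norm_rieszFellerSymbol, Complex.norm_real, Complex.norm_real, Real.norm_eq_abs,
      Real.norm_eq_abs, abs_of_nonneg hc,
      abs_of_nonneg (show 0 ≤ γ * k ^ 2 by positivity)]

lemma continuous_abs_rpow (hα₀ : 0 < α) : Continuous fun k : ℝ => |k| ^ α :=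
  continuous_abs.rpow_const fun _ => Or.inr hα₀.le

lemma tendstoUniformly_nhdsGT_zero {F : ℝ≥0 → ℝ → ℝ} {G : ℝ → ℝ}
    (h : ∀ ε > 0, ∃ t₀ > 0, ∀ t : ℝ≥0, 0 < t → (t : ℝ) ≤ t₀ → ∀ x, |F t x - G x| ≤ ε) :
    TendstoUniformly F G (𝓝[>] 0) := by
  rw [Metric.tendstoUniformly_iff]
  intro ε hε
  obtain ⟨t₀, ht₀, H⟩ := h (ε / 2) (by positivity)
  filter_upwards [Ioo_mem_nhdsGT (show (0 : ℝ≥0) < ⟨t₀, ht₀.le⟩ from ht₀)] with t ht x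
  have hle : (t : ℝ) ≤ t₀ := ht.2.le
  rw [dist_comm, Real.dist_eq]
  linarith [H t ht.1 hle x]

lemma isConvolutionSemigroup_caputoHeatKernel (hα₀ : 0 < α) (hα₁ : α < 1) (hc : 0 ≤ c)
    (hγ : 0 ≤ γ) : IsConvolutionSemigroup (caputoHeatKernel α c γ) where
  isProbabilityMeasure := isProbabilityMeasure_caputoHeatKernel hα₀ hα₁ hc
  zero := by simp [caputoHeatKernel, rieszFellerLaw]
  add s t := by
    have ip := fun t => isProbabilityMeasure_caputoHeatKernel (γ := γ) hα₀ hα₁ hc t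
    refine Measure.ext_of_charFun (funext fun k => ?_)
    simp only [charFun_conv, charFun_caputoHeatKernel hα₀ hα₁ hc hγ, ← Complex.exp_add]
    congr 1
    push_cast
    ring
  tendsto f hf := by
    obtain ⟨B, -, hB⟩ := hf.exists_bound
    have hcont := continuous_abs_rpow hα₀
    refine tendstoUniformly_nhdsGT_zero fun ε hε => ?_
    obtain ⟨t₀, ht₀, h⟩ := exists_abs_convOp_sub_le_of_charFun hf.uniformContinuous hB
      (D := fun k => c * |k| ^ α + γ * k ^ 2) (by fun_prop) hε
    exact ⟨t₀, ht₀, fun t _ ht => h t t.coe_nonneg ht _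
      (isProbabilityMeasure_caputoHeatKernel hα₀ hα₁ hc t)
      (norm_one_sub_charFun_caputoHeatKernel_le hα₀ hα₁ hc hγ t)⟩

/-- With `μ` stable and `ν` Gaussian, `μ∗ν∗f - f` is split as `μ∗(ν∗f - f - γt f'') + γt μ∗f'' +
(μ∗f - f)`. Replacing `μ∗f''` by `f''` costs `γtη`, the Gaussian error is `2γtη` and the stable one
`ctη`, whence the factor `c + 3γ` in `η`. -/
lemma exists_abs_convOp_caputoHeatKernel_sub_le (hα₀ : 0 < α) (hα₁ : α < 1) (hc : 0 ≤ c)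
    (hγ : 0 ≤ γ) {f : ℝ → ℝ} (hf : IsC02 f) {ε : ℝ} (hε : 0 < ε) :
    ∃ t₀ > 0, ∀ t : ℝ≥0, (t : ℝ) ≤ t₀ → ∀ x,
      |convOp (caputoHeatKernel α c γ t) f x - f x
        - t * (c * caputoGenerator α f x + γ * deriv (deriv f) x)| ≤ t * ε := by
  obtain ⟨B, -, hB⟩ := hf.2.1.exists_bound
  obtain ⟨C, -, hC⟩ := hf.2.2.2.exists_bound
  have hfc : Continuous f := hf.2.1.1
  have hdc : Continuous (deriv (deriv f)) := hf.2.2.2.1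
  set η := ε / (c + 3 * γ + 1) with hη
  have hη0 : 0 < η := by positivity
  obtain ⟨t₁, ht₁, h1⟩ := exists_abs_convOp_rieszFellerLaw_sub_le hα₀ hα₁ hf hη0
  obtain ⟨t₂, ht₂, h2⟩ := exists_abs_convOp_gaussianReal_sub_le hf hη0
  obtain ⟨t₃, ht₃, h3⟩ := exists_abs_convOp_sub_le_of_charFun hf.2.2.2.uniformContinuous hC
    (continuous_abs_rpow hα₀) hη0
  refine ⟨min (t₁ / (c + 1)) (min (t₂ / (2 * γ + 1)) (t₃ / (c + 1))), by positivity,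
    fun t ht x => ?_⟩
  have ht0 := t.coe_nonneg
  have hct : 0 ≤ c * t := by positivity
  have hv : ((Real.toNNReal (2 * γ * t) : ℝ≥0) : ℝ) = 2 * γ * t :=
    Real.coe_toNNReal _ (by positivity)
  simp only [le_min_iff] at ht
  obtain ⟨ha, hb, hd⟩ := ht
  rw [le_div_iff₀ (by positivity)] at ha hb hd
  set μ := rieszFellerLaw α (-α) (c * t) with hμ
  set ν := gaussianReal 0 (Real.toNNReal (2 * γ * t)) with hν
  have hμp : IsProbabilityMeasure μ := isProbabilityMeasure_rieszFellerLaw hα₀ hα₁ hct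
  have e1 := h1 (c * t) hct (by nlinarith) x
  have e2 := h2 (Real.toNNReal (2 * γ * t)) (by rw [hv]; nlinarith)
  have e3 := h3 (c * t) hct (by nlinarith) μ hμp
    (norm_one_sub_charFun_rieszFellerLaw_le hα₀ hα₁ hct) x
  rw [hv] at e2
  have e4 := abs_convOp_le (μ := μ) e2 x
  have hνc : Continuous (convOp ν f) := continuous_convOp hfc hB
  have hνB : ∀ x, |convOp ν f x| ≤ B := abs_convOp_le hB
  rw [convOp_sub (B := B + B) (C := 2 * γ * t / 2 * C) (by fun_prop)
    (fun z => (abs_sub _ _).trans (add_le_add (hνB z) (hB z))) (by fun_prop) (fun z => ?_),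
    convOp_sub hνc hνB hfc hB, convOp_const_mul, ← convOp_conv hfc hB] at e4
  · have e5 : |γ * t * (convOp μ (deriv (deriv f)) x - deriv (deriv f) x)| ≤ γ * t * η := by
      rw [abs_mul, abs_of_nonneg (by positivity)]
      gcongr
    have e6 : t * ((c + 3 * γ) * η) ≤ t * ε := by
      gcongr
      rw [hη, mul_div_assoc', div_le_iff₀ (by positivity)]
      nlinarith
    rw [caputoHeatKernel]
    rw [abs_le] at *
    constructor <;> linarith
  · rw [abs_mul, abs_of_nonneg (by positivity)]
    gcongr
    exact hC z

lemma isHeatKernel_caputoHeatKernel (hα₀ : 0 < α) (hα₁ : α < 1) {γ₁ γ₂ : ℝ} (h₁ : γ₁ ≤ 0)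
    (h₂ : 0 ≤ γ₂) : IsHeatKernel (caputoDiffusion α γ₁ γ₂) (caputoHeatKernel α |γ₁| γ₂) where
  semigroup := isConvolutionSemigroup_caputoHeatKernel hα₀ hα₁ (abs_nonneg _) h₂
  generator f hf := by
    refine tendstoUniformly_nhdsGT_zero fun ε hε => ?_
    obtain ⟨t₀, ht₀, h⟩ := exists_abs_convOp_caputoHeatKernel_sub_le hα₀ hα₁ (abs_nonneg γ₁) h₂
      hf hε
    refine ⟨t₀, ht₀, fun t ht htt x => ?_⟩
    have ht' : (0 : ℝ) < t := ht
    have hx := h t htt x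
    rw [caputoDiffusion_eq hα₀ hα₁ _ _ hf, ← abs_of_nonpos h₁]
    refine le_of_mul_le_mul_left ?_ ht'
    rw [← abs_of_pos ht', ← abs_mul, abs_of_pos ht']
    refine (le_of_eq ?_).trans hx
    congr 1
    unfold convOp
    field_simp

/-- For `γ = 0` both factors are carried by `[0,∞)`, so the negative half-line is null, which a
positive density excludes. For `γ > 0` the density is an average of translates of a positive
Gaussian density. -/
lemma hasStrictlyPositiveDensity_caputoHeatKernel_iff (hα₀ : 0 < α) (hα₁ : α < 1) (hc : 0 ≤ c)
    (hγ : 0 ≤ γ) {t : ℝ≥0} (ht : 0 < t) :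
    HasStrictlyPositiveDensity (caputoHeatKernel α c γ t) ↔ 0 < γ := by
  have ht' : (0 : ℝ) < t := ht
  have hct : 0 ≤ c * t := by positivity
  have hμp := isProbabilityMeasure_rieszFellerLaw hα₀ hα₁ hct
  constructor
  · rintro ⟨g, hg, hpos, h⟩
    refine lt_of_le_of_ne hγ fun h0 => ?_
    have hnull : caputoHeatKernel α c γ t (Set.Iio 0) = 0 :=
      conv_Iio_zero (rieszFellerLaw_Iio_zero hα₀ hα₁ hct) (by simp [← h0])
    rw [h, withDensity_apply _ measurableSet_Iio, lintegral_eq_zero_iff (by fun_prop)] at hnull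
    have hfalse : ∀ᵐ x ∂(volume.restrict (Set.Iio (0 : ℝ))), False := by
      filter_upwards [hnull] with x hx
      exact absurd (ENNReal.ofReal_eq_zero.1 hx) (not_le.2 (hpos x))
    rw [eventually_false_iff_eq_bot, ae_eq_bot, Measure.restrict_eq_zero] at hfalse
    simp at hfalse
  · intro hγ'
    refine hasStrictlyPositiveDensity_conv_gaussianReal _ ?_
    rw [Ne, Real.toNNReal_eq_zero, not_le]
    positivity

end HeatKernel

/-! ### The main theorem -/

theorem mainTheorem3 (α γ₁ γ₂ : ℝ) (hα₀ : 0 < α) (hα₁ : α < 1) :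
    -- the Caputo derivative is defined on `C₀²(ℝ)`
    (∀ f : ℝ → ℝ, IsC02 f → ∀ x : ℝ, CaputoConverges α f x) ∧
    -- the operator is a Lévy operator iff `γ₁ ≤ 0` and `γ₂ ≥ 0`
    (IsLevyOperator (caputoDiffusion α γ₁ γ₂) ↔ γ₁ ≤ 0 ∧ 0 ≤ γ₂) ∧
    -- `G^α_{-α}(·,τ)` is a one-sided `α`-stable density
    (∀ τ : ℝ, 0 < τ → IsOneSidedStableDensity α (fun x => rieszFellerKernel α (-α) x τ)) ∧
    -- in that case there is exactly one heat kernel; it is the convolution of the one-sided stable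
    -- law with a Gaussian law, and it is strictly positive iff `γ₂ > 0`
    (IsLevyOperator (caputoDiffusion α γ₁ γ₂) →
      ∃ p : ℝ≥0 → Measure ℝ,
        IsHeatKernel (caputoDiffusion α γ₁ γ₂) p ∧
        (∀ q : ℝ≥0 → Measure ℝ, IsHeatKernel (caputoDiffusion α γ₁ γ₂) q → q = p) ∧
        (∀ (t : ℝ≥0) (k : ℝ), charFun (p t) k =
          Complex.exp (((|γ₁| : ℝ) * rieszFellerSymbol α (-α) k - (γ₂ * k ^ 2 : ℝ)) * (t : ℝ))) ∧
        (∀ t : ℝ≥0, p t = (rieszFellerLaw α (-α) (|γ₁| * t)).conv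
          (gaussianReal 0 (Real.toNNReal (2 * γ₂ * t)))) ∧
        (∀ t : ℝ≥0, 0 < t → (HasStrictlyPositiveDensity (p t) ↔ 0 < γ₂))) := by

  refine ⟨fun f hf x => caputoConverges hα₀ hα₁ hf x, isLevyOperator_caputoDiffusion_iff hα₀ hα₁,
    fun τ hτ => isOneSidedStableDensity_rieszFellerKernel hα₀ hα₁ hτ, fun hL => ?_⟩
  obtain ⟨h₁, h₂⟩ := (isLevyOperator_caputoDiffusion_iff hα₀ hα₁).1 hL
  have hk := isHeatKernel_caputoHeatKernel hα₀ hα₁ h₁ h₂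
  exact ⟨caputoHeatKernel α |γ₁| γ₂, hk, fun q hq => hk.unique hq,
    charFun_caputoHeatKernel hα₀ hα₁ (abs_nonneg _) h₂, fun t => rfl,
    fun t ht => hasStrictlyPositiveDensity_caputoHeatKernel_iff hα₀ hα₁ (abs_nonneg _) h₂ ht⟩
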